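/- A weighted graph $(E,\omega)$ consists of countable sets $E^0$ (vertices) and $E^{\mathrm{st}}$ (structured edges), source and range maps $s,r:E^{\mathrm{st}}\to E^0$ and a weight map $\omega:E^{\mathrm{st}}\to\{1,2,3,\dots\}$; each $\alpha\in E^{\mathrm{st}}$ gives distinct edges $\alpha_1,\dots,\alpha_{\omega(\alpha)}$, and $E^1$ is the set of all of these. All weighted graphs are assumed to be row-finite, i.e. $s^{-1}(v)$ is finite for every $v\in E^0$. For $v\in E^0$ that is not a sink (i.e. $s^{-1}(v)\neq\emptyset$) put $\omega(v)=\max\{\omega(\alpha)\mid \alpha\in s^{-1}(v)\}$. Let $R$ be a unital, not necessarily commutative ring. Let $X=E^0\cup E^1\cup\{\alpha_i^*\mid\alpha_i\in E^1\}$ (a disjoint union), and let $R\langle X\rangle$ be the free left $R$-module on the nonempty words over $X$, with the multiplication $(\sum_x r_x x)(\sum_y s_y y)=\sum_{x,y} r_xs_y\,xy$. The weighted Leavitt path algebra $L_R(E,\omega)$ is the quotient of the (non-unital) ring $R\langle X\rangle$ by the two-sided ideal and $R$-subbimodule generated by the relations 1. $vw=\delta_{vw}v$ for all $v,w\in E^0$;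 2. $s(\alpha)\alpha_i=\alpha_i=\alpha_i r(\alpha)$ and $r(\alpha)\alpha_i^*=\alpha_i^*=\alpha_i^*s(\alpha)$ for all $\alpha\in E^{\mathrm{st}}$, $1\le i\le\omega(\alpha)$; 3. $\sum_{\alpha\in s^{-1}(v)}\alpha_i\alpha_j^*=\delta_{ij}v$ for all $v\in E^0$ that are not sinks and all $1\le i,j\le\omega(v)$; 4. $\sum_{1\le i\le\max\{\omega(\alpha),\omega(\beta)\}}\alpha_i^*\beta_i=\delta_{\alpha\beta}r(\alpha)$ for all $\alpha,\beta\in E^{\mathrm{st}}$, where in (3) and (4) $\alpha_i$ and $\alpha_i^*$ are read as $0$ if $i>\omega(\alpha)$. Call $(E,\omega)$ an LV-graph if $E^{\mathrm{st}}\neq\emptyset$; $(E,\omega)$ is connected (any two vertices are joined by a path that may traverse edges in either direction); $\omega(\alpha)\ge 2$ for all $\alpha\in E^{\mathrm{st}}$; and for every $v\in E^0$ that is not a sink at least two $\alpha\in s^{-1}(v)$ satisfy $\omega(\alpha)=\omega(v)$. A not necessarily unital ring $A$ is called right nonsingular if the only $a\in A$ whose right annihilator $\{b\in A\mid ab=0\}$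 is an essential right ideal (one that has nonzero intersection with every nonzero right ideal of $A$) is $a=0$. Left nonsingular is defined symmetrically, with left annihilators $\{b\in A\mid ba=0\}$ and left ideals. **Theorem.** If $(E,\omega)$ is an LV-graph and $R$ is a (not necessarily commutative) domain, i.e. a nonzero unital ring without zero divisors, then $L_R(E,\omega)$ is left and right nonsingular. -/

import Mathlib

open scoped MonoidAlgebra

/-- A row-finite weighted graph with vertex set `V` and set of structured edges `E`: source and
range maps, a weight map with positive values, and only finitely many structured edges starting
at each vertex. The edges are the pairs `(α, i)` with `i : Fin (weight α)`; thus the edges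
`α₁, …, α_{ω(α)}` are numbered here from `0` to `ω(α) - 1`. -/
structure WeightedGraph (V E : Type*) where
  src : E → V
  rng : E → V
  weight : E → ℕ
  weight_pos : ∀ α, 0 < weight α
  rowFinite : ∀ v, {α | src α = v}.Finite

namespace WeightedGraph

universe u v w

variable {V : Type u} {E : Type v} (G : WeightedGraph V E)

/-- The alphabet `X = E⁰ ∪ E¹ ∪ (E¹)*`. -/
inductive Letter : Type (max u v)
  | vertex (x : V) : Letter
  | edge (α : E) (i : Fin (G.weight α)) : Letter
  | ghost (α : E) (i : Fin (G.weight α)) : Letter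

/-- The source of a letter, as used for generalised paths. -/
def Letter.source {G : WeightedGraph V E} : G.Letter → V
  | .vertex x => x
  | .edge α _ => G.src α
  | .ghost α _ => G.rng α

/-- The range of a letter, as used for generalised paths. -/
def Letter.range {G : WeightedGraph V E} : G.Letter → V
  | .vertex x => x
  | .edge α _ => G.rng α
  | .ghost α _ => G.src α

/-- There is a generalised path from `x` to `y`: a chain of consecutive edges and ghost edges
(letters that are vertices only add trivial steps). -/
def Linked (x y : V) : Prop :=
  Relation.ReflTransGen (fun a b => ∃ l : G.Letter, l.source = a ∧ l.range = b) x y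

/-- The graph is connected: there is exactly one connected component. -/
def Connected : Prop := Nonempty V ∧ ∀ x y : V, G.Linked x y

/-- The finite set `s⁻¹(x)` of structured edges starting at `x`. -/
noncomputable def out (x : V) : Finset E := (G.rowFinite x).toFinset

/-- `ω(x)`, the maximal weight of a structured edge starting at `x` (it is `0` if `x` is a sink,
where it is not used). -/
noncomputable def maxWeight (x : V) : ℕ := (G.out x).sup G.weight

/-- LV-graphs: connected weighted graphs with at least one structured edge, such that all weights
are at least `2` and every vertex that is not a sink emits at least two structured edges of
maximal weight. -/
structure IsLV : Prop where
  nonempty : Nonempty E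
  connected : G.Connected
  two_le_weight : ∀ α, 2 ≤ G.weight α
  two_le_card : ∀ x, (G.out x).Nonempty →
    2 ≤ ((G.out x).filter fun α => G.weight α = G.maxWeight x).card

section Algebra

variable (R : Type w) [Ring R]

/-- The free `R`-ring `R⟨X⟩`: the free left `R`-module on the nonempty words over `X`, with
`(∑ rₓ x)(∑ s_y y) = ∑ rₓ s_y xy`. It is not unital. -/
abbrev FreeRing : Type (max u v w) := MonoidAlgebra R (FreeSemigroup G.Letter)

/-- The generator of the free `R`-ring given by a letter. -/
noncomputable def gen (l : G.Letter) : G.FreeRing R := MonoidAlgebra.single (FreeSemigroup.of l) 1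

/-- The vertex `x` in the free `R`-ring. -/
noncomputable def vtx (x : V) : G.FreeRing R := G.gen R (.vertex x)

/-- The edge `αᵢ` in the free `R`-ring, which is zero if `i` is out of range. -/
noncomputable def edg (α : E) (i : ℕ) : G.FreeRing R :=
  if h : i < G.weight α then G.gen R (.edge α ⟨i, h⟩) else 0

/-- The ghost edge `αᵢ*` in the free `R`-ring, which is zero if `i` is out of range. -/
noncomputable def gho (α : E) (i : ℕ) : G.FreeRing R :=
  if h : i < G.weight α then G.gen R (.ghost α ⟨i, h⟩) else 0

open Classical in
/-- The defining relations `a = b` of the weighted Leavitt path algebra. -/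
inductive LeavittRel : G.FreeRing R → G.FreeRing R → Prop
  | vertex_mul (x y : V) :
      LeavittRel (G.vtx R x * G.vtx R y) (if x = y then G.vtx R x else 0)
  | src_edge (α : E) (i : ℕ) (hi : i < G.weight α) :
      LeavittRel (G.vtx R (G.src α) * G.edg R α i) (G.edg R α i)
  | edge_rng (α : E) (i : ℕ) (hi : i < G.weight α) :
      LeavittRel (G.edg R α i * G.vtx R (G.rng α)) (G.edg R α i)
  | rng_ghost (α : E) (i : ℕ) (hi : i < G.weight α) :
      LeavittRel (G.vtx R (G.rng α) * G.gho R α i) (G.gho R α i)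
  | ghost_src (α : E) (i : ℕ) (hi : i < G.weight α) :
      LeavittRel (G.gho R α i * G.vtx R (G.src α)) (G.gho R α i)
  | sum_edge_ghost (x : V) (i j : ℕ) (hi : i < G.maxWeight x) (hj : j < G.maxWeight x) :
      LeavittRel (∑ α ∈ G.out x, G.edg R α i * G.gho R α j) (if i = j then G.vtx R x else 0)
  | sum_ghost_edge (α β : E) :
      LeavittRel
        (∑ i ∈ Finset.range (max (G.weight α) (G.weight β)), G.gho R α i * G.edg R β i)
        (if α = β then G.vtx R (G.rng α) else 0)

/-- The ideal of the `R`-ring `R⟨X⟩` (a two-sided ideal that is an `R`-subbimodule) generated by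
the relations. -/
noncomputable def leavittIdeal : TwoSidedIdeal (G.FreeRing R) :=
  sInf {J | (∀ (r : R), ∀ a ∈ J, r • a ∈ J) ∧ (∀ (r : R), ∀ a ∈ J, MulOpposite.op r • a ∈ J) ∧
    ∀ a b, G.LeavittRel R a b → a - b ∈ J}

/-- The weighted Leavitt path algebra `L_R(E, ω)`. -/
abbrev LeavittPathAlgebra : Type (max u v w) := (G.leavittIdeal R).ringCon.Quotient

end Algebra

end WeightedGraph

section Nonsingular

variable {A : Type*} [NonUnitalRing A]

/-- Right ideals of a not necessarily unital ring. -/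
def IsRightIdeal (J : AddSubgroup A) : Prop := ∀ x ∈ J, ∀ a : A, x * a ∈ J

/-- Left ideals of a not necessarily unital ring. -/
def IsLeftIdeal (J : AddSubgroup A) : Prop := ∀ x ∈ J, ∀ a : A, a * x ∈ J

/-- The right annihilator `{b | a * b = 0}`. -/
def rightAnnihilator (a : A) : AddSubgroup A := (AddMonoidHom.mulLeft a).ker

/-- The left annihilator `{b | b * a = 0}`. -/
def leftAnnihilator (a : A) : AddSubgroup A := (AddMonoidHom.mulRight a).ker

/-- Essential right ideals: those that meet every nonzero right ideal nontrivially. -/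
def IsEssentialRightIdeal (I : AddSubgroup A) : Prop :=
  IsRightIdeal I ∧ ∀ J : AddSubgroup A, IsRightIdeal J → J ≠ ⊥ → I ⊓ J ≠ ⊥

/-- Essential left ideals: those that meet every nonzero left ideal nontrivially. -/
def IsEssentialLeftIdeal (I : AddSubgroup A) : Prop :=
  IsLeftIdeal I ∧ ∀ J : AddSubgroup A, IsLeftIdeal J → J ≠ ⊥ → I ⊓ J ≠ ⊥

variable (A)

/-- Right nonsingular: only zero has an essential right annihilator. -/
def IsRightNonsingular : Prop :=
  ∀ a : A, IsEssentialRightIdeal (rightAnnihilator a) → a = 0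

/-- Left nonsingular: only zero has an essential left annihilator. -/
def IsLeftNonsingular : Prop :=
  ∀ a : A, IsEssentialLeftIdeal (leftAnnihilator a) → a = 0

end Nonsingular

/-!
An edge `αᵢ` is the entry in row `i` and column `α` of a matrix attached to the vertex `s(α)`, and
the ghost edge `αᵢ*` is an entry of the adjoint matrix, so relations (3) and (4) say that the two
matrices are inverse to each other. Regard the rows `1 ≤ i ≤ ω(v)` at the non-sinks `v` and the
columns `α` as the nodes of a bipartite graph, whose darts (oriented edges) `αᵢ` and `αᵢ*` run
between `i` and `α` in the two directions. Then (3) and (4) become one relation `d * d = 1`, whose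
entry at a pair of nodes `x`, `z` is a sum over their common neighbours. Solving each such
relation for the product through a chosen common neighbour, the pivot, leaves the normal words,
which are linearly independent because they carry a representation of the algebra.

The condition on LV-graphs says that `x` and `z` always have a second common neighbour `t`. If the
leading words of two normal forms `l` and `m` end in `(x, y)` and start with `(y, z)`, then
`l * m = 0` would force the leading coefficients of the words with `t` in place of `y` to be
nonzero as well, and then the irreducible product of `(x, t)` and `(y, z)` could not cancel. So
`a * v ≠ 0` and `v * b ≠ 0` imply `a * v * b ≠ 0` for a vertex `v`. Hence if `a * v ≠ 0`, the
right annihilator of `a` meets the right ideal generated by `v` trivially, and likewise on the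
left.
-/

/-- A graph in which every node `x` has finitely many neighbours and a distinguished neighbour
`pivot x`, which is the same for any two nodes with a common neighbour, and whose nodes are
labelled by `vertex`. Its oriented edges generate the algebras presented by `IsDartFamily`; the
pivots say which product is eliminated from each relation between quadratic monomials. -/
structure PivotedGraph (N V : Type*) where
  graph : SimpleGraph N
  finite_neighborSet : ∀ x, (graph.neighborSet x).Finite
  pivot : N → N
  vertex : N → V
  adj_pivot : ∀ x, graph.Adj x (pivot x)
  pivot_eq_pivot : ∀ {x y z}, graph.Adj x y → graph.Adj y z → pivot x = pivot z

namespace PivotedGraph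

open scoped Classical

variable {N V : Type*} (P : PivotedGraph N V)

/-- The finite set of common neighbours of two nodes. -/
noncomputable def between (x z : N) : Finset N :=
  ((P.finite_neighborSet x).subset (P.graph.commonNeighbors_subset_neighborSet_left x z)).toFinset

variable {P} in
theorem mem_between {x y z : N} : y ∈ P.between x z ↔ P.graph.Adj x y ∧ P.graph.Adj z y := by
  simp only [between, Set.Finite.mem_toFinset, SimpleGraph.mem_commonNeighbors]

theorem pivot_mem_between {x z : N} (h : P.pivot x = P.pivot z) : P.pivot x ∈ P.between x z :=
  mem_between.2 ⟨P.adj_pivot x, h ▸ P.adj_pivot z⟩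

variable {P} in
theorem pivot_eq_pivot_pivot {x y : N} (h : P.graph.Adj x y) :
    P.pivot y = P.pivot (P.pivot x) :=
  P.pivot_eq_pivot h.symm (P.adj_pivot x)

variable {P} in
theorem mem_between_pivot_pivot {x y : N} :
    y ∈ P.between x (P.pivot (P.pivot x)) ↔ P.graph.Adj x y :=
  mem_between.trans ⟨And.left, fun h => ⟨h, pivot_eq_pivot_pivot h ▸ (P.adj_pivot y).symm⟩⟩

/-- The relations imposed on elements `e v`, for labels `v`, and `d x y`, for oriented edges
`(x, y)`: the `e v` are orthogonal idempotents, `d x y` leads from `vertex x` to `vertex y`, and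
the matrix `d` satisfies `d * d = 1` on each block of nodes with the same pivot. The values of `d`
on pairs of nodes that are not adjacent are irrelevant. -/
structure IsDartFamily {A : Type*} [NonUnitalRing A] (e : V → A) (d : N → N → A) : Prop where
  vertex_mul_vertex : ∀ v w, e v * e w = if v = w then e v else 0
  vertex_mul_dart : ∀ {x y}, P.graph.Adj x y → e (P.vertex x) * d x y = d x y
  dart_mul_vertex : ∀ {x y}, P.graph.Adj x y → d x y * e (P.vertex y) = d x y
  sum_dart_mul_dart : ∀ {x z}, P.pivot x = P.pivot z →
    ∑ y ∈ P.between x z, d x y * d y z = if x = z then e (P.vertex x) else 0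

namespace IsDartFamily

variable {P} {A : Type*} [NonUnitalRing A] {e : V → A} {d : N → N → A}

theorem dart_mul_dart_of_ne (h : P.IsDartFamily e d) {x y z t : N} (hxy : P.graph.Adj x y)
    (hzt : P.graph.Adj z t) (hyz : P.vertex y ≠ P.vertex z) : d x y * d z t = 0 := by
  rw [← h.dart_mul_vertex hxy, ← h.vertex_mul_dart hzt, mul_assoc, ← mul_assoc (e _),
    h.vertex_mul_vertex, if_neg hyz, zero_mul, mul_zero]

theorem map {B : Type*} [NonUnitalRing B] (h : P.IsDartFamily e d) (f : A →ₙ+* B) :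
    P.IsDartFamily (fun v => f (e v)) (fun x y => f (d x y)) where
  vertex_mul_vertex v w := by rw [← map_mul, h.vertex_mul_vertex, apply_ite f, map_zero]
  vertex_mul_dart hxy := by rw [← map_mul, h.vertex_mul_dart hxy]
  dart_mul_vertex hxy := by rw [← map_mul, h.dart_mul_vertex hxy]
  sum_dart_mul_dart hxz := by
    simp only [← map_mul, ← map_sum, h.sum_dart_mul_dart hxz, apply_ite f, map_zero]

theorem vertex_mul_sum (h : P.IsDartFamily e d) {v : V} {F : Finset V} (hv : v ∈ F) :
    e v * ∑ w ∈ F, e w = e v := by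
  simp only [Finset.mul_sum, h.vertex_mul_vertex, Finset.sum_ite_eq, if_pos hv]

theorem sum_mul_vertex (h : P.IsDartFamily e d) {v : V} {F : Finset V} (hv : v ∈ F) :
    (∑ w ∈ F, e w) * e v = e v := by
  simp only [Finset.sum_mul, h.vertex_mul_vertex, Finset.sum_ite_eq', if_pos hv]

end IsDartFamily

/-! ### Normal words -/

/-- The label at which a word of oriented edges starts; the empty word stands for the idempotent
at `u`. -/
def wordSrc (u : V) : List (N × N) → V
  | [] => u
  | a :: _ => P.vertex a.1

/-- The consecutive pairs `(x, y), (y, z)` with `y = pivot x`, which are eliminated from normal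
words. -/
def Reducible (a b : N × N) : Prop := a.2 = b.1 ∧ a.2 = P.pivot a.1

/-- Normal words: paths of oriented edges that end at `u` and have no reducible pair of
consecutive letters. -/
def IsNormal (u : V) : List (N × N) → Prop
  | [] => True
  | a :: w => P.graph.Adj a.1 a.2 ∧ P.vertex a.2 = P.wordSrc u w ∧
      (∀ b ∈ w.head?, ¬ P.Reducible a b) ∧ IsNormal u w

/-- The type of normal words ending at `u`. -/
abbrev NormalWord (u : V) : Type _ := {w : List (N × N) // P.IsNormal u w}

variable {P} {u v : V} {x y z t : N} {w : List (N × N)}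

theorem IsNormal.tail {a : N × N} (h : P.IsNormal u (a :: w)) : P.IsNormal u w := h.2.2.2

theorem isNormal_nil : P.IsNormal u [] := trivial

theorem isNormal_singleton (a : N × N) :
    P.IsNormal u [a] ↔ P.graph.Adj a.1 a.2 ∧ P.vertex a.2 = u := by
  simp [IsNormal, wordSrc]

theorem isNormal_cons_cons (a b : N × N) : P.IsNormal u (a :: b :: w) ↔
    P.graph.Adj a.1 a.2 ∧ P.vertex a.2 = P.vertex b.1 ∧ ¬ P.Reducible a b ∧
      P.IsNormal u (b :: w) := by
  conv_lhs => rw [IsNormal]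
  simp [wordSrc]

theorem IsNormal.congr_head (h : P.IsNormal u ((z, t) :: w)) (hx : P.graph.Adj x t) :
    P.IsNormal u ((x, t) :: w) := by
  obtain ⟨ht, hv, hr, hw⟩ := h
  refine ⟨hx, hv, fun b hb hxb => hr b hb ⟨hxb.1, hxb.2.trans ?_⟩, hw⟩
  exact P.pivot_eq_pivot hx ht.symm

/-! ### The representation on normal words -/

section Operators

variable {R : Type*} [Ring R]

/-- A word as an element of the free module on the normal words ending at `u`, where a word that is
not normal is read as `0`. -/
noncomputable def mono (w : List (N × N)) : P.NormalWord u →₀ R :=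
  if h : P.IsNormal u w then Finsupp.single ⟨w, h⟩ 1 else 0

theorem mono_of_isNormal (h : P.IsNormal u w) :
    (mono w : P.NormalWord u →₀ R) = Finsupp.single ⟨w, h⟩ 1 := dif_pos h

theorem mono_of_not_isNormal (h : ¬ P.IsNormal u w) : (mono w : P.NormalWord u →₀ R) = 0 :=
  dif_neg h

/-- The normal form of the product of `(x, y)` with a normal word. -/
noncomputable def leftMul (x y : N) : List (N × N) → P.NormalWord u →₀ R
  | [] => mono [(x, y)]
  | b :: w =>
    if P.Reducible (x, y) b then
      (if x = b.2 then mono w else 0) -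
        ∑ t ∈ (P.between x b.2).erase y, mono ((x, t) :: (t, b.2) :: w)
    else mono ((x, y) :: b :: w)

variable (P u R) in
/-- Left multiplication by the oriented edge `(x, y)` on combinations of normal words. -/
noncomputable def dartOp (x y : N) : Module.End R (P.NormalWord u →₀ R) :=
  Finsupp.linearCombination R fun w => leftMul x y w.1

variable (P u R) in
/-- Left multiplication by the idempotent at `v` on combinations of normal words. -/
noncomputable def vertexOp (v : V) : Module.End R (P.NormalWord u →₀ R) :=
  Finsupp.linearCombination R fun w => if P.wordSrc u w.1 = v then mono w.1 else 0

theorem end_ext {M : Type*} [AddCommMonoid M] [Module R M] {f g : (P.NormalWord u →₀ R) →ₗ[R] M}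
    (h : ∀ w, P.IsNormal u w → f (mono w) = g (mono w)) : f = g :=
  Finsupp.lhom_ext' fun w => LinearMap.ext_ring <| by
    simpa [mono_of_isNormal w.2] using h w.1 w.2

theorem dartOp_mono (h : P.IsNormal u w) : P.dartOp u R x y (mono w) = leftMul x y w := by
  simp [dartOp, mono_of_isNormal h]

theorem vertexOp_mono :
    P.vertexOp u R v (mono w) = if P.wordSrc u w = v then mono w else 0 := by
  by_cases h : P.IsNormal u w
  · simp [vertexOp, mono_of_isNormal h]
  · simp [mono_of_not_isNormal h]

theorem leftMul_of_ne (h : P.vertex y ≠ P.wordSrc u w) :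
    (leftMul x y w : P.NormalWord u →₀ R) = 0 := by
  cases w with
  | nil => exact mono_of_not_isNormal fun hw => h hw.2.1
  | cons b w =>
    have hred : ¬ P.Reducible (x, y) b := fun hr => h (congrArg P.vertex hr.1)
    rw [leftMul, if_neg hred]
    exact mono_of_not_isNormal fun hw => h hw.2.1

theorem leftMul_of_isNormal (h : P.IsNormal u ((x, y) :: w)) :
    (leftMul x y w : P.NormalWord u →₀ R) = mono ((x, y) :: w) := by
  cases w with
  | nil => rfl
  | cons b w => rw [leftMul, if_neg (h.2.2.1 b rfl)]

theorem leftMul_pivot_cons : (leftMul x (P.pivot x) ((P.pivot x, z) :: w) : P.NormalWord u →₀ R) =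
    (if x = z then mono w else 0) -
      ∑ t ∈ (P.between x z).erase (P.pivot x), mono ((x, t) :: (t, z) :: w) :=
  if_pos ⟨rfl, rfl⟩

theorem leftMul_cons_of_ne (h : y ≠ P.pivot x) (b : N × N) :
    (leftMul x y (b :: w) : P.NormalWord u →₀ R) = mono ((x, y) :: b :: w) :=
  if_neg fun hr => h hr.2

theorem sum_leftMul_cons (h : P.pivot x = P.pivot z) :
    ∑ y ∈ P.between x z, leftMul x y ((y, z) :: w) =
      if x = z then (mono w : P.NormalWord u →₀ R) else 0 := by
  rw [← Finset.add_sum_erase _ _ (P.pivot_mem_between h), leftMul_pivot_cons,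
    Finset.sum_congr rfl fun y hy => leftMul_cons_of_ne (Finset.ne_of_mem_erase hy) (y, z),
    sub_add_cancel]

theorem vertexOp_leftMul (hw : P.IsNormal u w) :
    P.vertexOp u R (P.vertex x) (leftMul x y w) = leftMul x y w := by
  have fixes_mono (y : N) (w : List (N × N)) : P.vertexOp u R (P.vertex x) (mono ((x, y) :: w)) =
      mono ((x, y) :: w) := vertexOp_mono.trans (if_pos rfl)
  cases w with
  | nil => exact fixes_mono y []
  | cons b w =>
    rw [leftMul]
    split_ifs with hred hx
    · rw [map_sub, map_sum, vertexOp_mono, if_pos (hx ▸ hw.2.1.symm)]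
      simp only [fixes_mono]
    · simp only [map_sub, map_zero, map_sum, fixes_mono]
    · exact fixes_mono y _

theorem IsNormal.cons_congr_head (hw : P.IsNormal u ((z, t) :: w)) (hst : P.graph.Adj x t)
    (hyx : P.graph.Adj y x) (hx : x ≠ P.pivot y) : P.IsNormal u ((y, x) :: (x, t) :: w) :=
  (isNormal_cons_cons _ _).2 ⟨hyx, rfl, fun h => hx h.2, hw.congr_head hst⟩

theorem sum_dartOp_leftMul_of_ne (h : P.pivot x = P.pivot z) (hw : P.IsNormal u w)
    (hz : P.vertex z = P.wordSrc u w) (hhead : ∀ b ∈ w.head?, b.1 = z → z ≠ P.pivot (P.pivot x)) :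
    ∑ y ∈ P.between x z, P.dartOp u R x y (leftMul y z w) = if x = z then mono w else 0 := by
  refine (Finset.sum_congr rfl fun y hy => ?_).trans (sum_leftMul_cons h)
  obtain ⟨hxy, hzy⟩ := mem_between.1 hy
  have hyz : P.IsNormal u ((y, z) :: w) := by
    refine ⟨hzy.symm, hz, fun b hb hred => hhead b hb hred.1.symm ?_, hw⟩
    exact hred.2.trans (pivot_eq_pivot_pivot hxy)
  rw [leftMul_of_isNormal hyz, dartOp_mono hyz]

theorem dartOp_leftMul_pivot_cons (hw : P.IsNormal u ((P.pivot y, t) :: w)) :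
    P.dartOp u R x y (leftMul y (P.pivot y) ((P.pivot y, t) :: w)) =
      (if y = t then P.dartOp u R x t (mono w) else 0) -
        ∑ s ∈ (P.between y t).erase (P.pivot y), leftMul x y ((y, s) :: (s, t) :: w) := by
  rw [leftMul_pivot_cons, map_sub, map_sum, apply_ite (P.dartOp u R x y), map_zero]
  congr 1
  · split_ifs with hyt
    · rw [hyt]
    · rfl
  · refine Finset.sum_congr rfl fun s hs => dartOp_mono ?_
    obtain ⟨hsy, hs⟩ := Finset.mem_erase.1 hs
    obtain ⟨hys, hts⟩ := mem_between.1 hs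
    exact hw.cons_congr_head hts.symm hys hsy

theorem sum_dartOp_leftMul_pivot (h : P.pivot x = P.pivot z) (hz : z = P.pivot (P.pivot x))
    (hw : P.IsNormal u ((z, t) :: w)) :
    ∑ y ∈ P.between x z, P.dartOp u R x y (leftMul y z ((z, t) :: w)) =
      if x = z then mono ((z, t) :: w) else 0 := by
  have hzt : P.graph.Adj z t := hw.1
  have mem_iff {y : N} : y ∈ P.between x z ↔ P.graph.Adj x y := hz ▸ mem_between_pivot_pivot
  set S := (P.finite_neighborSet t).toFinset.erase z with hS
  have mem_S {s : N} : s ∈ S ↔ s ≠ z ∧ P.graph.Adj t s := by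
    simp only [hS, Finset.mem_erase, Set.Finite.mem_toFinset, SimpleGraph.mem_neighborSet]
  have expand (y : N) (hy : y ∈ P.between x z) :
      P.dartOp u R x y (leftMul y z ((z, t) :: w)) =
        (if y = t then P.dartOp u R x t (mono w) else 0) -
          ∑ s ∈ (P.between y t).erase z, leftMul x y ((y, s) :: (s, t) :: w) := by
    obtain rfl := hz.trans (pivot_eq_pivot_pivot (mem_iff.1 hy)).symm
    exact dartOp_leftMul_pivot_cons hw
  have swap : ∑ y ∈ P.between x z, ∑ s ∈ (P.between y t).erase z,
        (leftMul x y ((y, s) :: (s, t) :: w) : P.NormalWord u →₀ R) =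
      ∑ s ∈ S, ∑ y ∈ P.between x s, leftMul x y ((y, s) :: (s, t) :: w) := by
    refine Finset.sum_comm' fun y s => ?_
    rw [mem_iff, Finset.mem_erase, mem_between, mem_S, mem_between, P.graph.adj_comm s y]
    tauto
  have inner (s : N) (hs : s ∈ S) : ∑ y ∈ P.between x s,
      (leftMul x y ((y, s) :: (s, t) :: w) : P.NormalWord u →₀ R) =
        if x = s then mono ((s, t) :: w) else 0 :=
    sum_leftMul_cons (h.trans (P.pivot_eq_pivot hzt (mem_S.1 hs).2))
  have first : (if P.graph.Adj x t then P.dartOp u R x t (mono w) else 0) =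
      if P.graph.Adj x t then mono ((x, t) :: w) else 0 := by
    split_ifs with hxt
    · rw [dartOp_mono hw.tail, leftMul_of_isNormal (hw.congr_head hxt)]
    · rfl
  rw [Finset.sum_congr rfl expand, Finset.sum_sub_distrib, swap, Finset.sum_congr rfl inner,
    Finset.sum_ite_eq', Finset.sum_ite_eq, if_congr mem_iff rfl rfl, first, if_congr mem_S rfl rfl]
  by_cases hxz : x = z
  · simp [hxz, hzt]
  · simp [hxz, P.graph.adj_comm t x]

theorem sum_dartOp_leftMul (h : P.pivot x = P.pivot z) (hw : P.IsNormal u w)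
    (hz : P.vertex z = P.wordSrc u w) :
    ∑ y ∈ P.between x z, P.dartOp u R x y (leftMul y z w) = if x = z then mono w else 0 := by
  by_cases hhead : ∀ b ∈ w.head?, b.1 = z → z ≠ P.pivot (P.pivot x)
  · exact sum_dartOp_leftMul_of_ne h hw hz hhead
  · push Not at hhead
    obtain ⟨⟨z, t⟩, hb, rfl, hzx⟩ := hhead
    obtain ⟨w, rfl⟩ := List.head?_eq_some_iff.1 hb
    exact sum_dartOp_leftMul_pivot h hzx hw

variable (P u R) in
theorem isDartFamily_op : P.IsDartFamily (P.vertexOp u R) (P.dartOp u R) where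
  vertex_mul_vertex v v' := end_ext fun w _ => by
    rw [Module.End.mul_apply, vertexOp_mono, apply_ite (P.vertexOp u R v), vertexOp_mono, map_zero]
    split_ifs with h h' h' h' <;> simp_all [vertexOp_mono]
  vertex_mul_dart _ := end_ext fun w hw => by
    rw [Module.End.mul_apply, dartOp_mono hw, vertexOp_leftMul hw]
  dart_mul_vertex _ := end_ext fun w hw => by
    rw [Module.End.mul_apply, vertexOp_mono]
    split_ifs with h
    · rfl
    · rw [map_zero, dartOp_mono hw, leftMul_of_ne (Ne.symm h)]
  sum_dart_mul_dart {x z} h := end_ext fun w hw => by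
    simp only [LinearMap.sum_apply, Module.End.mul_apply, dartOp_mono hw]
    by_cases hz : P.vertex z = P.wordSrc u w
    · rw [sum_dartOp_leftMul h hw hz]
      split_ifs with hxz
      · rw [vertexOp_mono, hxz, if_pos hz.symm]
      · rfl
    · simp only [leftMul_of_ne hz, map_zero, Finset.sum_const_zero]
      split_ifs with hxz
      · rw [vertexOp_mono, hxz, if_neg (Ne.symm hz)]
      · rfl

end Operators

/-! ### Leading coefficients -/

section LeadingTerms

variable {R : Type*} [Ring R] {p q : List (N × N)} {a b : N × N}

theorem IsNormal.of_append (h : P.IsNormal u (p ++ q)) : P.IsNormal u q := by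
  induction p with
  | nil => exact h
  | cons a p ih => exact ih h.tail

theorem IsNormal.append_cons {r : List (N × N)} (hp : P.IsNormal v (p ++ (x, y) :: r))
    (hw : P.IsNormal u ((x, t) :: w)) : P.IsNormal u (p ++ (x, t) :: w) := by
  induction p with
  | nil => exact hw
  | cons a p ih =>
    cases p with
    | nil =>
      obtain ⟨ha, hax, hred, -⟩ := (isNormal_cons_cons _ _).1 hp
      exact (isNormal_cons_cons _ _).2 ⟨ha, hax, fun h => hred ⟨h.1, h.2⟩, hw⟩
    | cons b p =>
      obtain ⟨ha, hab, hred, hp⟩ := (isNormal_cons_cons _ _).1 hp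
      exact (isNormal_cons_cons _ _).2 ⟨ha, hab, hred, ih hp⟩

theorem IsNormal.append_cons_cons (hp : P.IsNormal v (p ++ [a])) (hq : P.IsNormal u (b :: q))
    (hv : P.vertex b.1 = v) (hab : ¬ P.Reducible a b) : P.IsNormal u (p ++ a :: b :: q) := by
  obtain ⟨ha, hav⟩ := (isNormal_singleton a).1 hp.of_append
  exact hp.append_cons ((isNormal_cons_cons a b).2 ⟨ha, hav.trans hv.symm, hab, hq⟩)

variable (P u R) in
/-- Left multiplication by a word of oriented edges on combinations of normal words. -/
noncomputable def wordOp (p : List (N × N)) : Module.End R (P.NormalWord u →₀ R) :=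
  (p.map fun a => P.dartOp u R a.1 a.2).prod

theorem wordOp_cons (m : P.NormalWord u →₀ R) :
    P.wordOp u R (a :: p) m = P.dartOp u R a.1 a.2 (P.wordOp u R p m) := by
  simp only [wordOp, List.map_cons, List.prod_cons, Module.End.mul_apply]

theorem wordOp_append (m : P.NormalWord u →₀ R) :
    P.wordOp u R (p ++ q) m = P.wordOp u R p (P.wordOp u R q m) := by
  simp only [wordOp, List.map_append, List.prod_append, Module.End.mul_apply]

theorem wordOp_mono (h : P.IsNormal u (p ++ q)) : P.wordOp u R p (mono q) = mono (p ++ q) := by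
  induction p with
  | nil => rfl
  | cons a p ih =>
    have tail : P.IsNormal u (p ++ q) := h.tail
    rw [wordOp_cons, ih tail, dartOp_mono tail]
    exact leftMul_of_isNormal h

variable (P u R) in
/-- The combinations of normal words of length at most `n`. -/
def lengthLE (n : ℕ) : Submodule R (P.NormalWord u →₀ R) :=
  Finsupp.supported R R {w | w.1.length ≤ n}

theorem mono_mem_lengthLE {n : ℕ} (h : w.length ≤ n) : mono w ∈ P.lengthLE u R n := by
  by_cases hw : P.IsNormal u w
  · rw [mono_of_isNormal hw]
    exact Finsupp.single_mem_supported R 1 h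
  · rw [mono_of_not_isNormal hw]
    exact zero_mem _

theorem leftMul_mem_lengthLE {n : ℕ} (h : w.length ≤ n) :
    leftMul x y w ∈ P.lengthLE u R (n + 1) := by
  cases w with
  | nil => exact mono_mem_lengthLE (by simp)
  | cons b w =>
    rw [List.length_cons] at h
    rw [leftMul]
    split_ifs
    · exact sub_mem (mono_mem_lengthLE (by lia))
        (sum_mem fun t _ => mono_mem_lengthLE (by simp only [List.length_cons]; lia))
    · exact sub_mem (zero_mem _)
        (sum_mem fun t _ => mono_mem_lengthLE (by simp only [List.length_cons]; lia))
    · exact mono_mem_lengthLE (by simp only [List.length_cons]; lia)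

theorem wordOp_mem_lengthLE {n : ℕ} {m : P.NormalWord u →₀ R} (hm : m ∈ P.lengthLE u R n) :
    P.wordOp u R p m ∈ P.lengthLE u R (p.length + n) := by
  induction p with
  | nil => simpa [wordOp] using hm
  | cons a p ih =>
    rw [wordOp_cons, dartOp, Finsupp.linearCombination_apply, List.length_cons, Nat.add_right_comm]
    exact sum_mem fun w hw => Submodule.smul_mem _ _ (leftMul_mem_lengthLE (ih hw))

/-- The coefficient of a word, which is `0` if the word is not normal. -/
noncomputable def coeff (w : List (N × N)) : (P.NormalWord u →₀ R) →ₗ[R] R :=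
  if h : P.IsNormal u w then Finsupp.lapply ⟨w, h⟩ else 0

theorem coeff_of_isNormal (h : P.IsNormal u w) (m : P.NormalWord u →₀ R) :
    coeff w m = m ⟨w, h⟩ := by rw [coeff, dif_pos h, Finsupp.lapply_apply]

theorem isNormal_of_coeff_ne_zero {m : P.NormalWord u →₀ R} (h : coeff w m ≠ 0) :
    P.IsNormal u w := by
  by_contra hw
  exact h (by rw [coeff, dif_neg hw, LinearMap.zero_apply])

theorem coeff_mono (h : P.IsNormal u p) :
    coeff w (mono p : P.NormalWord u →₀ R) = if p = w then 1 else 0 := by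
  by_cases hw : P.IsNormal u w
  · rw [coeff_of_isNormal hw, mono_of_isNormal h, Finsupp.single_apply]
    simp only [Subtype.mk.injEq]
  · rw [coeff, dif_neg hw, LinearMap.zero_apply, if_neg fun hpw : p = w => hw (hpw ▸ h)]

theorem coeff_eq_zero_of_mem_lengthLE {n : ℕ} {m : P.NormalWord u →₀ R}
    (hm : m ∈ P.lengthLE u R n) (hw : n < w.length) : coeff w m = 0 := by
  by_contra h
  rw [coeff_of_isNormal (isNormal_of_coeff_ne_zero h)] at h
  exact hw.not_ge (hm (Finsupp.mem_support_iff.2 h))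

theorem eq_of_mem_supported {M : Type*} [AddCommMonoid M] [Module R M] {s : Set (P.NormalWord u)}
    {f g : (P.NormalWord u →₀ R) →ₗ[R] M} (h : ∀ w ∈ s, f (mono w.1) = g (mono w.1))
    {m : P.NormalWord u →₀ R} (hm : m ∈ Finsupp.supported R R s) : f m = g m := by
  rw [Finsupp.supported_eq_span_single] at hm
  refine LinearMap.eqOn_span ?_ hm
  rintro _ ⟨w, hw, rfl⟩
  simpa only [mono_of_isNormal w.2] using h w hw

theorem eq_coeff_nil_smul_mono {m : P.NormalWord u →₀ R} (hm : m ∈ P.lengthLE u R 0) :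
    m = (coeff [] m : R) • mono [] := by
  refine eq_of_mem_supported (f := LinearMap.id)
    (g := (LinearMap.toSpanSingleton R _ (mono [])).comp (coeff [])) ?_ hm
  rintro ⟨w, hw⟩ hlen
  obtain rfl : w = [] := List.length_eq_zero_iff.1 (Nat.le_zero.1 hlen)
  simp [coeff_mono hw]

theorem coeff_wordOp_mono_of_pivot (hp : P.IsNormal v (p ++ [(x, P.pivot x)]))
    (hq : P.IsNormal u ((P.pivot x, z) :: q)) (hw : p.length + q.length < w.length) :
    coeff w (P.wordOp u R (p ++ [(x, P.pivot x)]) (mono ((P.pivot x, z) :: q))) =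
      -∑ t ∈ (P.between x z).erase (P.pivot x),
        if p ++ (x, t) :: (t, z) :: q = w then 1 else 0 := by
  have lower : P.wordOp u R p (if x = z then mono q else 0) ∈
      P.lengthLE u R (p.length + q.length) := by
    refine wordOp_mem_lengthLE ?_
    split_ifs
    exacts [mono_mem_lengthLE le_rfl, zero_mem _]
  have last (m : P.NormalWord u →₀ R) : P.wordOp u R [(x, P.pivot x)] m =
      P.dartOp u R x (P.pivot x) m := wordOp_cons m
  rw [wordOp_append, last, dartOp_mono hq, leftMul_pivot_cons, map_sub, map_sub,
    coeff_eq_zero_of_mem_lengthLE lower hw, zero_sub, map_sum, map_sum]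
  refine congrArg _ (Finset.sum_congr rfl fun t ht => ?_)
  obtain ⟨htx, ht⟩ := Finset.mem_erase.1 ht
  obtain ⟨hxt, hzt⟩ := mem_between.1 ht
  have normal : P.IsNormal u (p ++ (x, t) :: (t, z) :: q) :=
    hp.append_cons (hq.cons_congr_head hzt.symm hxt htx)
  rw [wordOp_mono normal, coeff_mono normal]

theorem append_cons_cons_inj {α : Type*} {p p' q q' : List α} {a a' b b' : α}
    (h : p'.length = p.length) :
    p' ++ a' :: b' :: q' = p ++ a :: b :: q ↔ (p' = p ∧ q' = q) ∧ a' = a ∧ b' = b := by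
  refine ⟨fun heq => ?_, by rintro ⟨⟨rfl, rfl⟩, rfl, rfl⟩; rfl⟩
  obtain ⟨hp, hq⟩ := List.append_inj heq h
  obtain ⟨ha, hb, hq⟩ : a' = a ∧ b' = b ∧ q' = q := by simpa only [List.cons.injEq] using hq
  exact ⟨⟨hp, hq⟩, ha, hb⟩

theorem sum_erase_pivot_ite (hab : a.2 = b.1 → a.2 ∈ (P.between a.1 b.2).erase (P.pivot a.1))
    (C : Prop) [Decidable C] : (∑ t ∈ (P.between x z).erase (P.pivot x),
      if C ∧ (x, t) = a ∧ (t, z) = b then (1 : R) else 0) =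
        if a.2 = b.1 ∧ C ∧ x = a.1 ∧ z = b.2 then 1 else 0 := by
  obtain ⟨a₁, a₂⟩ := a
  obtain ⟨b₁, b₂⟩ := b
  split_ifs with h
  · obtain ⟨rfl, hC, rfl, rfl⟩ := h
    rw [Finset.sum_eq_single_of_mem a₂ (hab rfl) fun t _ ht => if_neg fun h => ht ?_]
    · exact if_pos ⟨hC, rfl, rfl⟩
    · exact (Prod.ext_iff.1 h.2.1).2
  · refine Finset.sum_eq_zero fun t _ => if_neg ?_
    rintro ⟨hC, ha, hb⟩
    simp only [Prod.mk.injEq] at ha hb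
    exact h ⟨ha.2.symm.trans hb.1, hC, ha.1, hb.2⟩

theorem coeff_wordOp_append_mono_cons (hw : P.IsNormal u (p ++ a :: b :: q)) {p' q' : List (N × N)}
    {a' b' : N × N} (hp : P.IsNormal v (p' ++ [a'])) (hq : P.IsNormal u (b' :: q'))
    (hv : P.vertex b'.1 = v) (hpl : p'.length = p.length) (hql : q'.length = q.length) :
    coeff (p ++ a :: b :: q) (P.wordOp u R (p' ++ [a']) (mono (b' :: q'))) =
      (if (p' = p ∧ q' = q) ∧ a' = a ∧ b' = b then 1 else 0) -
        if a.2 = b.1 ∧ (p' = p ∧ q' = q) ∧ a' = (a.1, P.pivot a.1) ∧ b' = (P.pivot a.1, b.2)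
          then 1 else 0 := by
  obtain ⟨ha, -, hab, hbq⟩ := (isNormal_cons_cons a b).1 hw.of_append
  by_cases hred : P.Reducible a' b'
  · obtain ⟨x, _⟩ := a'
    obtain ⟨_, z⟩ := b'
    obtain ⟨rfl, rfl⟩ : _ = _ ∧ _ = P.pivot x := hred
    have mem (h : a.2 = b.1) : a.2 ∈ (P.between a.1 b.2).erase (P.pivot a.1) :=
      Finset.mem_erase.2 ⟨fun h' => hab ⟨h, h'⟩, mem_between.2 ⟨ha, h ▸ hbq.1.symm⟩⟩
    rw [coeff_wordOp_mono_of_pivot hp hq (by simp; lia)]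
    simp only [append_cons_cons_inj hpl]
    have not_eq : ¬ ((p' = p ∧ q' = q) ∧ (x, P.pivot x) = a ∧ (P.pivot x, z) = b) := by
      rintro ⟨-, rfl, rfl⟩
      exact hab ⟨rfl, rfl⟩
    rw [sum_erase_pivot_ite mem, if_neg not_eq, zero_sub, neg_inj]
    refine if_congr ?_ rfl rfl
    simp only [Prod.mk.injEq]
    grind
  · have normal := hp.append_cons_cons hq hv hred
    rw [wordOp_mono (by simpa using normal), List.append_assoc, List.singleton_append,
      coeff_mono normal, if_congr (append_cons_cons_inj hpl) rfl rfl]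
    refine (sub_eq_self.2 (if_neg ?_)).symm
    rintro ⟨-, -, rfl, rfl⟩
    exact hred ⟨rfl, rfl⟩

theorem coeff_wordOp_mono (hw : P.IsNormal u (p ++ a :: b :: q)) {p' q' : List (N × N)}
    (hp : P.IsNormal v p') (hq : P.IsNormal u q') (hv : P.wordSrc u q' = v)
    (hpl : p'.length ≤ p.length + 1) (hql : q'.length ≤ q.length + 1) :
    coeff (p ++ a :: b :: q) (P.wordOp u R p' (mono q')) =
      (if p' = p ++ [a] ∧ q' = b :: q then 1 else 0) -
        if a.2 = b.1 ∧ p' = p ++ [(a.1, P.pivot a.1)] ∧ q' = (P.pivot a.1, b.2) :: q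
          then 1 else 0 := by
  by_cases hlen : p'.length + q'.length < p.length + q.length + 2
  · have ne (a b : N × N) : ¬ (p' = p ++ [a] ∧ q' = b :: q) := by
      rintro ⟨rfl, rfl⟩
      simp only [List.length_append, List.length_cons, List.length_nil] at hlen
      lia
    rw [coeff_eq_zero_of_mem_lengthLE (wordOp_mem_lengthLE (mono_mem_lengthLE le_rfl))
      (by simpa [add_assoc] using hlen), if_neg (ne _ _), if_neg fun h => ne _ _ h.2, sub_zero]
  · obtain rfl | ⟨p', a', rfl⟩ := p'.eq_nil_or_concat'
    · simp only [List.length_nil] at hlen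
      lia
    obtain _ | ⟨b', q'⟩ := q'
    · simp only [List.length_append, List.length_cons, List.length_nil] at hlen hpl
      lia
    simp only [List.length_append, List.length_cons, List.length_nil] at hlen hpl hql
    rw [coeff_wordOp_append_mono_cons hw hp hq hv (by lia) (by lia)]
    congr 1
    · refine if_congr ?_ rfl rfl
      simp only [List.append_singleton_inj, List.cons.injEq]
      tauto
    · refine if_congr ?_ rfl rfl
      simp only [List.append_singleton_inj, List.cons.injEq]
      tauto

variable (P u R) in
/-- The combinations of normal words that start at `v`. -/
def startingAt (v : V) : Submodule R (P.NormalWord u →₀ R) :=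
  Finsupp.supported R R {w | P.wordSrc u w.1 = v}

/-- The product of a combination of normal words ending at `v` with an element of the module on
the normal words ending at `u`. -/
noncomputable def act (m : P.NormalWord u →₀ R) :
    (P.NormalWord v →₀ R) →ₗ[R] (P.NormalWord u →₀ R) :=
  Finsupp.linearCombination R fun p => P.wordOp u R p.1 m

theorem act_mono {m : P.NormalWord u →₀ R} (hp : P.IsNormal v p) :
    act m (mono p : P.NormalWord v →₀ R) = P.wordOp u R p m := by
  rw [mono_of_isNormal hp, act, Finsupp.linearCombination_single, one_smul]

theorem coeff_wordOp (hw : P.IsNormal u (p ++ a :: b :: q)) {p' : List (N × N)}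
    (hp : P.IsNormal v p') (hpl : p'.length ≤ p.length + 1) {m : P.NormalWord u →₀ R}
    (hm : m ∈ P.startingAt u R v) (hml : m ∈ P.lengthLE u R (q.length + 1)) :
    coeff (p ++ a :: b :: q) (P.wordOp u R p' m) =
      (if p' = p ++ [a] then coeff (b :: q) m else 0) -
        if a.2 = b.1 ∧ p' = p ++ [(a.1, P.pivot a.1)] then coeff ((P.pivot a.1, b.2) :: q) m
          else 0 := by
  let f : (P.NormalWord u →₀ R) →ₗ[R] R := (if p' = p ++ [a] then coeff (b :: q) else 0) -
    if a.2 = b.1 ∧ p' = p ++ [(a.1, P.pivot a.1)] then coeff ((P.pivot a.1, b.2) :: q) else 0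
  have on_mono (q' : P.NormalWord u) (hq' : q' ∈ {q' : P.NormalWord u | P.wordSrc u q'.1 = v} ∩
      {q' | q'.1.length ≤ q.length + 1}) :
      (coeff (p ++ a :: b :: q)).comp (P.wordOp u R p') (mono q'.1) = f (mono q'.1) := by
    rw [LinearMap.comp_apply, coeff_wordOp_mono hw hp q'.2 hq'.1 hpl hq'.2, LinearMap.sub_apply]
    congr 1
    · rw [ite_and, ← coeff_mono q'.2]
      split_ifs <;> rfl
    · rw [if_congr and_assoc.symm rfl rfl, ite_and, ← coeff_mono q'.2]
      split_ifs <;> rfl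
  have hmem : m ∈ Finsupp.supported R R (_ ∩ _) := (Finsupp.supported_inter _ _).ge ⟨hm, hml⟩
  refine (eq_of_mem_supported on_mono hmem).trans ?_
  rw [LinearMap.sub_apply]
  split_ifs <;> rfl

theorem coeff_act (hw : P.IsNormal u (p ++ a :: b :: q)) {l : P.NormalWord v →₀ R}
    (hl : l ∈ P.lengthLE v R (p.length + 1)) {m : P.NormalWord u →₀ R} (hm : m ∈ P.startingAt u R v)
    (hml : m ∈ P.lengthLE u R (q.length + 1)) :
    coeff (p ++ a :: b :: q) (act m l) = coeff (p ++ [a]) l * coeff (b :: q) m -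
      if a.2 = b.1 then coeff (p ++ [(a.1, P.pivot a.1)]) l * coeff ((P.pivot a.1, b.2) :: q) m
        else 0 := by
  let f : (P.NormalWord v →₀ R) →ₗ[R] R :=
    (coeff (p ++ [a])).smulRight (coeff (b :: q) m) - if a.2 = b.1 then
      (coeff (p ++ [(a.1, P.pivot a.1)])).smulRight (coeff ((P.pivot a.1, b.2) :: q) m) else 0
  have on_mono (p' : P.NormalWord v)
      (hp' : p' ∈ {p' : P.NormalWord v | p'.1.length ≤ p.length + 1}) :
      (coeff (p ++ a :: b :: q) ∘ₗ act (v := v) m) (mono p'.1) = f (mono p'.1) := by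
    rw [LinearMap.comp_apply, act_mono p'.2, coeff_wordOp hw p'.2 hp' hm hml, LinearMap.sub_apply]
    congr 1
    · rw [LinearMap.smulRight_apply, coeff_mono p'.2, ite_smul, one_smul, zero_smul]
    · rw [ite_and, apply_ite (fun g : (P.NormalWord v →₀ R) →ₗ[R] R => g (mono p'.1)),
        LinearMap.smulRight_apply, coeff_mono p'.2, ite_smul, one_smul, zero_smul,
        LinearMap.zero_apply]
  refine (eq_of_mem_supported on_mono hl).trans ?_
  rw [LinearMap.sub_apply]
  split_ifs <;> rfl

variable (P) in
/-- Any two nodes with the same pivot have a further common neighbour. -/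
def IsBranching : Prop := ∀ x z, P.pivot x = P.pivot z → (P.between x z).Nontrivial

theorem exists_coeff_ne_zero {m : P.NormalWord u →₀ R} (hm : m ≠ 0) :
    ∃ p, coeff p m ≠ 0 ∧ m ∈ P.lengthLE u R p.length := by
  obtain ⟨p, hp, longest⟩ :=
    m.support.exists_max_image (fun p => p.1.length) (Finsupp.support_nonempty_iff.2 hm)
  exact ⟨p.1, by rwa [coeff_of_isNormal p.2, ← Finsupp.mem_support_iff], longest⟩

theorem wordSrc_of_coeff_ne_zero {m : P.NormalWord u →₀ R} (hm : m ∈ P.startingAt u R v)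
    (h : coeff w m ≠ 0) : P.wordSrc u w = v := by
  rw [coeff_of_isNormal (isNormal_of_coeff_ne_zero h)] at h
  exact hm (Finsupp.mem_support_iff.2 h)

theorem act_ne_zero_of_coeff_nil_ne_zero [NoZeroDivisors R] {l : P.NormalWord v →₀ R}
    {m : P.NormalWord u →₀ R} (hl : l ∈ P.lengthLE v R 0) (hl₀ : coeff [] l ≠ 0) (hm : m ≠ 0) :
    act m l ≠ 0 := by
  rw [eq_coeff_nil_smul_mono hl, map_smul, act_mono isNormal_nil]
  exact smul_ne_zero hl₀ hm

theorem coeff_act_smul_mono_nil (s : R) (l : P.NormalWord u →₀ R) :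
    coeff p (act (s • mono [] : P.NormalWord u →₀ R) l) = coeff p l * s := by
  suffices coeff p ∘ₗ act (s • mono [] : P.NormalWord u →₀ R) = (coeff p).smulRight s from
    LinearMap.congr_fun this l
  refine end_ext fun w hw => ?_
  rw [LinearMap.comp_apply, act_mono hw, map_smul, wordOp_mono (by rwa [List.append_nil]),
    List.append_nil, map_smul, LinearMap.smulRight_apply, coeff_mono hw, smul_ite, ite_smul,
    one_smul, zero_smul, smul_zero, smul_eq_mul, mul_one]

section Cancellation

variable {l : P.NormalWord v →₀ R} {m : P.NormalWord u →₀ R}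

theorem coeff_mul_coeff_eq_zero (hact : act m l = 0) (hl : l ∈ P.lengthLE v R (p.length + 1))
    (hm : m ∈ P.startingAt u R v) (hml : m ∈ P.lengthLE u R (q.length + 1)) (hab : a.2 ≠ b.1) :
    coeff (p ++ [a]) l * coeff (b :: q) m = 0 := by
  by_contra hne
  have hp := left_ne_zero_of_mul hne
  have hq := right_ne_zero_of_mul hne
  have normal : P.IsNormal u (p ++ a :: b :: q) :=
    (isNormal_of_coeff_ne_zero hp).append_cons_cons (isNormal_of_coeff_ne_zero hq)
      (wordSrc_of_coeff_ne_zero hm hq) fun h => hab h.1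
  have := coeff_act normal hl hm hml
  rw [hact, map_zero, if_neg hab, sub_zero] at this
  exact hne this.symm

theorem coeff_mul_coeff_eq_pivot (hact : act m l = 0) (hl : l ∈ P.lengthLE v R (p.length + 1))
    (hm : m ∈ P.startingAt u R v) (hml : m ∈ P.lengthLE u R (q.length + 1))
    (ht : t ∈ P.between x z) :
    coeff (p ++ [(x, t)]) l * coeff ((t, z) :: q) m =
      coeff (p ++ [(x, P.pivot x)]) l * coeff ((P.pivot x, z) :: q) m := by
  by_cases htx : t = P.pivot x
  · rw [htx]
  by_cases normal : P.IsNormal u (p ++ (x, t) :: (t, z) :: q)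
  · have := coeff_act normal hl hm hml
    rwa [hact, map_zero, if_pos rfl, eq_comm, sub_eq_zero] at this
  obtain ⟨hxt, hzt⟩ := mem_between.1 ht
  trans 0
  · by_contra hne
    have hp := left_ne_zero_of_mul hne
    have hq := right_ne_zero_of_mul hne
    exact normal ((isNormal_of_coeff_ne_zero hp).append_cons_cons (isNormal_of_coeff_ne_zero hq)
      (wordSrc_of_coeff_ne_zero hm hq) fun h => htx h.2)
  · by_contra hne
    have hp := left_ne_zero_of_mul (Ne.symm hne)
    have hq := right_ne_zero_of_mul (Ne.symm hne)
    exact normal ((isNormal_of_coeff_ne_zero hp).append_cons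
      ((isNormal_of_coeff_ne_zero hq).cons_congr_head hzt.symm hxt htx))

/-- A leading pair `(x, y), (y, z)` could be traded for `(x, t), (t, z)` with `t ≠ y`, which makes
the leading coefficient of `(x, t), (y, z)` nonzero as well; but that pair is not eliminated. -/
theorem act_ne_zero [NoZeroDivisors R] (hP : P.IsBranching) (hm : m ∈ P.startingAt u R v)
    (hl₀ : l ≠ 0) (hm₀ : m ≠ 0) : act m l ≠ 0 := by
  obtain ⟨p, hp, hpl⟩ := exists_coeff_ne_zero hl₀
  obtain ⟨q, hq, hqm⟩ := exists_coeff_ne_zero hm₀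
  obtain rfl | ⟨p, ⟨x, y⟩, rfl⟩ := p.eq_nil_or_concat'
  · exact act_ne_zero_of_coeff_nil_ne_zero hpl hp hm₀
  obtain _ | ⟨b, q⟩ := q
  · obtain rfl : u = v := wordSrc_of_coeff_ne_zero hm hq
    intro hact
    rw [eq_coeff_nil_smul_mono hqm] at hact
    exact mul_ne_zero hp hq (by rw [← coeff_act_smul_mono_nil, hact, map_zero])
  intro hact
  rw [List.length_append] at hpl
  have zero := fun {a b} => coeff_mul_coeff_eq_zero (a := a) (b := b) hact hpl hm hqm
  obtain rfl : y = b.1 := by_contra fun hyb => mul_ne_zero hp hq (zero hyb)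
  have hxy := ((isNormal_singleton _).1 (isNormal_of_coeff_ne_zero hp).of_append).1
  have hyz := (isNormal_of_coeff_ne_zero hq).1
  obtain ⟨t, ht, hty⟩ := (hP x b.2 (P.pivot_eq_pivot hxy hyz)).exists_ne b.1
  have trade : coeff (p ++ [(x, t)]) l * coeff ((t, b.2) :: q) m =
      coeff (p ++ [(x, b.1)]) l * coeff (b :: q) m :=
    (coeff_mul_coeff_eq_pivot hact hpl hm hqm ht).trans
      (coeff_mul_coeff_eq_pivot hact hpl hm hqm (mem_between.2 ⟨hxy, hyz.symm⟩)).symm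
  have hpt : coeff (p ++ [(x, t)]) l ≠ 0 :=
    left_ne_zero_of_mul (trade.trans_ne (mul_ne_zero hp hq))
  exact mul_ne_zero hpt hq (zero hty)

end Cancellation

end LeadingTerms

/-! ### Normal words in an algebra -/

section Eval

variable {R : Type*} [Ring R] {A : Type*} [NonUnitalRing A] {e : V → A} {d : N → N → A}

/-- The value of a word of oriented edges ending at `u`, given the values `e` of the vertices and
`d` of the oriented edges. -/
def wordElt (e : V → A) (d : N → N → A) (u : V) : List (N × N) → A
  | [] => e u
  | a :: w => d a.1 a.2 * wordElt e d u w

theorem map_wordElt_mono_nil {f : A →ₙ+* AddMonoid.End (P.NormalWord u →₀ R)}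
    (he : ∀ m, f (e u) m = P.vertexOp u R u m)
    (hd : ∀ {x y}, P.graph.Adj x y → ∀ m, f (d x y) m = P.dartOp u R x y m)
    (hw : P.IsNormal u w) : f (wordElt e d u w) (mono []) = mono w := by
  induction w with
  | nil => exact (he _).trans (vertexOp_mono.trans (if_pos rfl))
  | cons a w ih =>
    rw [wordElt, map_mul, AddMonoid.End.coe_mul, Function.comp_apply, ih hw.tail, hd hw.1,
      dartOp_mono hw.tail]
    exact leftMul_of_isNormal hw

variable [Module R A]

/-- The value of a combination of normal words ending at `u`. -/
noncomputable def eval (e : V → A) (d : N → N → A) (u : V) : (P.NormalWord u →₀ R) →ₗ[R] A :=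
  Finsupp.linearCombination R fun w => wordElt e d u w.1

theorem eval_mono (h : P.IsNormal u w) :
    eval e d u (mono w : P.NormalWord u →₀ R) = wordElt e d u w := by
  rw [mono_of_isNormal h, eval, Finsupp.linearCombination_single, one_smul]

@[elab_as_elim]
theorem mono_induction {p : (P.NormalWord u →₀ R) → Prop} (add : ∀ l m, p l → p m → p (l + m))
    (smul : ∀ (r : R) w, P.IsNormal u w → p (r • mono w)) (m : P.NormalWord u →₀ R) : p m := by
  induction m using Finsupp.induction_linear with
  | zero => simpa only [zero_smul] using smul 0 [] isNormal_nil
  | add l m hl hm => exact add l m hl hm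
  | single w r =>
    simpa only [mono_of_isNormal w.2, Finsupp.smul_single, smul_eq_mul, mul_one] using
      smul r w.1 w.2

theorem eval_apply_eq_mul {f : Module.End R (P.NormalWord u →₀ R)} {c : A}
    (hc : ∀ (r : R) a, c * r • a = r • (c * a))
    (hf : ∀ w, P.IsNormal u w → eval e d u (f (mono w)) = c * wordElt e d u w)
    (m : P.NormalWord u →₀ R) : eval e d u (f m) = c * eval e d u m := by
  induction m using mono_induction with
  | add l m hl hm => simp only [map_add, mul_add, hl, hm]
  | smul r w hw => simp only [map_smul, hc, hf w hw, eval_mono hw]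

theorem vertexOp_of_mem_startingAt {m : P.NormalWord u →₀ R} (hm : m ∈ P.startingAt u R v) :
    P.vertexOp u R v m = m :=
  eq_of_mem_supported (g := LinearMap.id) (fun _ hw => vertexOp_mono.trans (if_pos hw)) hm

theorem vertexOp_mem_startingAt (m : P.NormalWord u →₀ R) :
    P.vertexOp u R v m ∈ P.startingAt u R v := by
  rw [vertexOp, Finsupp.linearCombination_apply]
  refine sum_mem fun w _ => Submodule.smul_mem _ _ ?_
  split_ifs with h
  · rw [mono_of_isNormal w.2]
    exact Finsupp.single_mem_supported R 1 h
  · exact zero_mem _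

theorem eval_injective {f : A →ₙ+* AddMonoid.End (P.NormalWord u →₀ R)}
    (hf : ∀ (r : R) a m, f (r • a) m = r • f a m) (he : ∀ m, f (e u) m = P.vertexOp u R u m)
    (hd : ∀ {x y}, P.graph.Adj x y → ∀ m, f (d x y) m = P.dartOp u R x y m) :
    Function.Injective (eval e d u : (P.NormalWord u →₀ R) → A) := by
  have leftInverse (m : P.NormalWord u →₀ R) : f (eval e d u m) (mono []) = m := by
    induction m using mono_induction with
    | add l m hl hm =>
      rw [map_add, map_add]
      exact congrArg₂ (· + ·) hl hm
    | smul r w hw => rw [map_smul, hf, eval_mono hw, map_wordElt_mono_nil he hd hw]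
  exact Function.LeftInverse.injective (g := fun a => f a (mono [])) leftInverse

namespace IsDartFamily

variable (h : P.IsDartFamily e d)

include h

theorem vertex_mul_wordElt (hw : P.IsNormal u w) :
    e v * wordElt e d u w = if P.wordSrc u w = v then wordElt e d u w else 0 := by
  cases w with
  | nil =>
    rw [wordElt, h.vertex_mul_vertex, wordSrc]
    by_cases huv : u = v
    · rw [huv]
    · rw [if_neg huv, if_neg (Ne.symm huv)]
  | cons a w =>
    rw [wordElt, ← h.vertex_mul_dart hw.1, ← mul_assoc, ← mul_assoc, h.vertex_mul_vertex, ite_mul,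
      ite_mul, zero_mul, zero_mul, if_congr (eq_comm (a := v)) rfl rfl]
    exact ite_congr rfl (fun huv => by rw [← huv, wordSrc]) fun _ => rfl

theorem dart_mul_wordElt_of_ne (hxy : P.graph.Adj x y) (hw : P.IsNormal u w)
    (hyw : P.vertex y ≠ P.wordSrc u w) : d x y * wordElt e d u w = 0 := by
  rw [← h.dart_mul_vertex hxy, mul_assoc, h.vertex_mul_wordElt hw, if_neg hyw.symm, mul_zero]

theorem eval_leftMul_pivot_cons (hw : P.IsNormal u ((P.pivot x, z) :: w)) :
    eval e d u (leftMul x (P.pivot x) ((P.pivot x, z) :: w) : P.NormalWord u →₀ R) =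
      d x (P.pivot x) * wordElt e d u ((P.pivot x, z) :: w) := by
  have eval_term (t : N) (ht : t ∈ (P.between x z).erase (P.pivot x)) :
      eval e d u (mono ((x, t) :: (t, z) :: w) : P.NormalWord u →₀ R) =
        d x t * d t z * wordElt e d u w := by
    obtain ⟨htx, ht⟩ := Finset.mem_erase.1 ht
    obtain ⟨hxt, hzt⟩ := mem_between.1 ht
    rw [eval_mono (hw.cons_congr_head hzt.symm hxt htx), wordElt, wordElt, mul_assoc]
  have hxz : P.pivot x = P.pivot z := P.pivot_eq_pivot (P.adj_pivot x) hw.1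
  have relation := h.sum_dart_mul_dart hxz
  rw [← Finset.add_sum_erase _ _ (P.pivot_mem_between hxz), ← eq_sub_iff_add_eq] at relation
  rw [leftMul_pivot_cons, map_sub, map_sum, Finset.sum_congr rfl eval_term, ← Finset.sum_mul,
    wordElt, ← mul_assoc, relation, sub_mul, ite_mul, zero_mul]
  congr 1
  split_ifs with hx
  · rw [eval_mono hw.tail, h.vertex_mul_wordElt hw.tail, if_pos (hx ▸ hw.2.1.symm)]
  · exact map_zero _

theorem eval_leftMul (hxy : P.graph.Adj x y) (hw : P.IsNormal u w) :
    eval e d u (leftMul x y w : P.NormalWord u →₀ R) = d x y * wordElt e d u w := by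
  by_cases hyw : P.vertex y = P.wordSrc u w
  swap
  · rw [leftMul_of_ne hyw, map_zero, h.dart_mul_wordElt_of_ne hxy hw hyw]
  by_cases hred : ∀ b ∈ w.head?, ¬ P.Reducible (x, y) b
  · have normal : P.IsNormal u ((x, y) :: w) := ⟨hxy, hyw, hred, hw⟩
    rw [leftMul_of_isNormal normal, eval_mono normal, wordElt]
  · push Not at hred
    obtain ⟨⟨b, z⟩, hb, hyb, hyx⟩ := hred
    obtain ⟨w, rfl⟩ := List.head?_eq_some_iff.1 hb
    obtain rfl : y = b := hyb
    obtain rfl : y = P.pivot x := hyx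
    exact h.eval_leftMul_pivot_cons hw

theorem eval_vertexOp (he : ∀ (r : R) a, e v * r • a = r • (e v * a)) (m : P.NormalWord u →₀ R) :
    eval e d u (P.vertexOp u R v m) = e v * eval e d u m := by
  refine eval_apply_eq_mul he (fun w hw => ?_) m
  rw [vertexOp_mono, apply_ite (eval e d u), map_zero, eval_mono hw, h.vertex_mul_wordElt hw]

theorem eval_dartOp (hxy : P.graph.Adj x y) (hd : ∀ (r : R) a, d x y * r • a = r • (d x y * a))
    (m : P.NormalWord u →₀ R) :
    eval e d u (P.dartOp u R x y m) = d x y * eval e d u m :=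
  eval_apply_eq_mul hd (fun w hw => by rw [dartOp_mono hw, h.eval_leftMul hxy hw]) m

variable (he : ∀ v (r : R) a, e v * r • a = r • (e v * a))
  (hd : ∀ x y (r : R) a, d x y * r • a = r • (d x y * a))

include he hd

theorem wordElt_mul_eval {m : P.NormalWord u →₀ R} (hm : m ∈ P.startingAt u R v)
    (hw : P.IsNormal v w) :
    wordElt e d v w * eval e d u m = eval e d u (P.wordOp u R w m) := by
  induction w with
  | nil => rw [wordElt, ← h.eval_vertexOp (he v), vertexOp_of_mem_startingAt hm]; rfl
  | cons a w ih => rw [wordElt, mul_assoc, ih hw.tail, wordOp_cons, h.eval_dartOp hw.1 (hd _ _)]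

theorem eval_mul_eval [IsScalarTower R A A] {m : P.NormalWord u →₀ R} (hm : m ∈ P.startingAt u R v)
    (l : P.NormalWord v →₀ R) : eval e d v l * eval e d u m = eval e d u (act m l) := by
  induction l using mono_induction with
  | add l l' hl hl' => simp only [map_add, add_mul, hl, hl']
  | smul r w hw =>
    rw [map_smul, map_smul, smul_mul_assoc, eval_mono hw, act_mono hw,
      h.wordElt_mul_eval he hd hm hw, map_smul]

end IsDartFamily

end Eval

end PivotedGraph

section SemigroupAction

variable {R S M : Type*} [Ring R] [Mul S] [AddCommGroup M] [Module R M]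

/-- The action of a semigroup algebra on an `R`-module given by an action of the semigroup by
`R`-linear maps. It is only additive, as `R` need not be commutative. -/
noncomputable def addEndOfMulHom (f : S →ₙ* Module.End R M) : R[S] →ₙ+* AddMonoid.End M :=
  let g : S →ₙ* AddMonoid.End M :=
    (Module.toAddMonoidEnd (Module.End R M) M : Module.End R M →ₙ* AddMonoid.End M).comp f
  { MonoidAlgebra.liftNC (Module.toAddMonoidEnd R M : R →+ AddMonoid.End M) g with
    map_zero' := map_zero _
    map_mul' := fun a b => MonoidAlgebra.liftNC_mul (Module.toAddMonoidEnd R M) g a b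
      fun {_ y} _ => AddMonoidHom.ext fun m => ((f y).map_smul _ m).symm }

variable (f : S →ₙ* Module.End R M)

theorem addEndOfMulHom_single (s : S) (r : R) (m : M) :
    addEndOfMulHom f (.single s r) m = r • f s m :=
  DFunLike.congr_fun (MonoidAlgebra.liftNC_single _ _ s r) m

theorem addEndOfMulHom_smul (r : R) (a : R[S]) (m : M) :
    addEndOfMulHom f (r • a) m = r • addEndOfMulHom f a m := by
  induction a using MonoidAlgebra.induction_linear with
  | zero => rw [smul_zero, map_zero]; exact (smul_zero r).symm
  | add a b ha hb =>
    rw [smul_add, map_add, map_add]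
    exact (congrArg₂ (· + ·) ha hb).trans (smul_add r _ _).symm
  | single s t =>
    rw [MonoidAlgebra.smul_single, addEndOfMulHom_single, addEndOfMulHom_single, smul_eq_mul,
      mul_smul]

theorem addEndOfMulHom_op_smul (r : R) (a : R[S]) (m : M) :
    addEndOfMulHom f (MulOpposite.op r • a) m = addEndOfMulHom f a (r • m) := by
  induction a using MonoidAlgebra.induction_linear with
  | zero => rw [smul_zero, map_zero]; rfl
  | add a b ha hb =>
    rw [smul_add, map_add, map_add]
    exact congrArg₂ (· + ·) ha hb
  | single s t =>
    rw [MonoidAlgebra.smul_single, addEndOfMulHom_single, addEndOfMulHom_single, op_smul_eq_mul,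
      mul_smul, map_smul]

end SemigroupAction

namespace WeightedGraph

open scoped Classical

variable {V E : Type*} (G : WeightedGraph V E)

/-! ### The darts of a weighted graph -/

/-- The nodes of the dart graph: the edge `αᵢ` is seen as the entry in row `i` and column `α` of a
matrix attached to the source of `α`, and its ghost as an entry of the adjoint matrix. -/
inductive Node
  | row (x : V) (i : Fin (G.maxWeight x))
  | col (α : E)

variable {G} {x : V} {α β : E} {i j : ℕ}

theorem mem_out : α ∈ G.out x ↔ G.src α = x := by
  simp only [out, Set.Finite.mem_toFinset, Set.mem_ofPred_eq]

theorem weight_le_maxWeight (α : E) : G.weight α ≤ G.maxWeight (G.src α) :=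
  Finset.le_sup (mem_out.2 rfl)

theorem exists_weight_eq_maxWeight (h : 0 < G.maxWeight x) :
    ∃ α, G.src α = x ∧ G.weight α = G.maxWeight x := by
  have nonempty : (G.out x).Nonempty :=
    Finset.nonempty_iff_ne_empty.2 fun hx => h.ne' (by rw [maxWeight, hx, Finset.sup_empty]; rfl)
  obtain ⟨α, hα, hmax⟩ := Finset.exists_mem_eq_sup _ nonempty G.weight
  exact ⟨α, mem_out.1 hα, hmax.symm⟩

/-- A structured edge of maximal weight starting at `x`. -/
noncomputable def topEdge (h : 0 < G.maxWeight x) : E := (exists_weight_eq_maxWeight h).choose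

theorem src_topEdge (h : 0 < G.maxWeight x) : G.src (topEdge h) = x :=
  (exists_weight_eq_maxWeight h).choose_spec.1

theorem weight_topEdge (h : 0 < G.maxWeight x) : G.weight (topEdge h) = G.maxWeight x :=
  (exists_weight_eq_maxWeight h).choose_spec.2

theorem eq_of_topEdge_eq {y : V} {hx : 0 < G.maxWeight x} {hy : 0 < G.maxWeight y}
    (h : topEdge hx = topEdge hy) : x = y := by
  rw [← src_topEdge hx, h, src_topEdge]

theorem maxWeight_src_pos (α : E) : 0 < G.maxWeight (G.src α) :=
  (G.weight_pos α).trans_le (weight_le_maxWeight α)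

theorem row_zero_congr {x y : V} (h : x = y) (hx : 0 < G.maxWeight x) (hy : 0 < G.maxWeight y) :
    Node.row x ⟨0, hx⟩ = Node.row y ⟨0, hy⟩ := by subst h; rfl

variable (G) in
/-- The bipartite graph whose oriented edges are the edges of `G`, leading from rows to columns, and
their ghosts, leading from columns to rows. -/
def dartSimpleGraph : SimpleGraph G.Node where
  Adj
    | .row x i, .col α => G.src α = x ∧ i < G.weight α
    | .col α, .row x i => G.src α = x ∧ i < G.weight α
    | _, _ => False
  symm := ⟨by rintro (_ | _) (_ | _) h <;> exact h⟩
  loopless := ⟨by rintro (_ | _) h <;> exact h⟩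

variable (G) in
/-- The pivot of the rows at `x` is a structured edge of maximal weight, so that it meets them all;
the pivot of a column is the first row at its source. -/
noncomputable def dartGraph : PivotedGraph G.Node V where
  graph := G.dartSimpleGraph
  finite_neighborSet
    | .row x _ => ((G.out x).finite_toSet.image .col).subset <| by
        rintro (_ | α) h
        exacts [h.elim, ⟨α, mem_out.2 h.1, rfl⟩]
    | .col α => (Set.finite_range (Node.row (G.src α))).subset <| by
        rintro (⟨x, i⟩ | _) h
        · obtain ⟨rfl, -⟩ := h
          exact ⟨i, rfl⟩
        · exact h.elim
  pivot
    | .row _ i => .col (topEdge i.pos)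
    | .col α => .row (G.src α) ⟨0, maxWeight_src_pos α⟩
  vertex
    | .row x _ => x
    | .col α => G.rng α
  adj_pivot
    | .row _ i => ⟨src_topEdge i.pos, i.2.trans_eq (weight_topEdge i.pos).symm⟩
    | .col α => ⟨rfl, G.weight_pos α⟩
  pivot_eq_pivot {a b c} hab hbc := by
    obtain ⟨x, i⟩ | α := a <;> obtain ⟨y, j⟩ | β := b <;> obtain ⟨z, k⟩ | γ := c
    all_goals first | exact hab.elim | exact hbc.elim | skip
    · obtain ⟨rfl, -⟩ := hab
      obtain ⟨rfl, -⟩ := hbc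
      rfl
    · obtain ⟨rfl, -⟩ := hab
      exact row_zero_congr hbc.1.symm _ _

theorem pivot_row_eq_pivot_row (i j : Fin (G.maxWeight x)) :
    G.dartGraph.pivot (.row x i) = G.dartGraph.pivot (.row x j) := rfl

theorem pivot_col_eq_pivot_col (h : G.src α = G.src β) :
    G.dartGraph.pivot (.col α) = G.dartGraph.pivot (.col β) := row_zero_congr h _ _

theorem adj_row (hi : i < G.weight α) :
    G.dartGraph.graph.Adj (.row (G.src α) ⟨i, hi.trans_le (weight_le_maxWeight α)⟩) (.col α) :=
  ⟨rfl, hi⟩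

theorem adj_col (hi : i < G.weight α) :
    G.dartGraph.graph.Adj (.col α) (.row (G.src α) ⟨i, hi.trans_le (weight_le_maxWeight α)⟩) :=
  ⟨rfl, hi⟩

theorem between_row_row (i j : Fin (G.maxWeight x)) :
    G.dartGraph.between (.row x i) (.row x j) =
      ((G.out x).filter fun α => i < G.weight α ∧ j < G.weight α).image .col := by
  ext (_ | α)
  · simp [PivotedGraph.mem_between, dartGraph, dartSimpleGraph]
  · simp only [PivotedGraph.mem_between, Finset.mem_image, Finset.mem_filter, mem_out,
      Node.col.injEq, exists_eq_right]
    exact ⟨fun ⟨⟨hx, hi⟩, _, hj⟩ => ⟨hx, hi, hj⟩, fun ⟨hx, hi, hj⟩ => ⟨⟨hx, hi⟩, hx, hj⟩⟩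

theorem between_col_col (h : G.src α = G.src β) :
    G.dartGraph.between (.col α) (.col β) =
      (Finset.univ.filter fun i : Fin (G.maxWeight (G.src α)) =>
        i < G.weight α ∧ i < G.weight β).image (.row (G.src α)) := by
  ext (⟨x, i⟩ | _)
  · simp only [PivotedGraph.mem_between, Finset.mem_image, Finset.mem_filter, Finset.mem_univ,
      true_and]
    constructor
    · rintro ⟨⟨rfl, hα⟩, -, hβ⟩
      exact ⟨i, ⟨hα, hβ⟩, rfl⟩
    · rintro ⟨j, ⟨hα, hβ⟩, hj⟩
      cases hj
      exact ⟨⟨rfl, hα⟩, h.symm, hβ⟩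
  · simp [PivotedGraph.mem_between, dartGraph, dartSimpleGraph]

theorem isBranching_dartGraph (two_le_weight : ∀ α, 2 ≤ G.weight α)
    (two_le_card : ∀ x, (G.out x).Nonempty →
      2 ≤ ((G.out x).filter fun α => G.weight α = G.maxWeight x).card) :
    G.dartGraph.IsBranching := by
  rintro (⟨x, i⟩ | α) (⟨y, j⟩ | β) h
  · obtain rfl : x = y := eq_of_topEdge_eq (Node.col.inj h)
    have nonempty : (G.out x).Nonempty := ⟨topEdge i.pos, mem_out.2 (src_topEdge i.pos)⟩
    obtain ⟨α, hα, β, hβ, hne⟩ := Finset.one_lt_card.1 (two_le_card x nonempty)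
    have mem_between {γ : E} (hγ : γ ∈ (G.out x).filter fun γ => G.weight γ = G.maxWeight x) :
        .col γ ∈ G.dartGraph.between (.row x i) (.row x j) := by
      obtain ⟨hγx, hγ⟩ := Finset.mem_filter.1 hγ
      rw [between_row_row]
      exact Finset.mem_image_of_mem _
        (Finset.mem_filter.2 ⟨hγx, i.2.trans_eq hγ.symm, j.2.trans_eq hγ.symm⟩)
    exact ⟨_, mem_between hα, _, mem_between hβ, fun hαβ => hne (Node.col.inj hαβ)⟩
  · cases h
  · cases h
  · have hαβ : G.src α = G.src β := (Node.row.inj h).1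
    have mem_between {k : ℕ} (hk : k < 2) :
        .row (G.src α) ⟨k, (hk.trans_le (two_le_weight α)).trans_le (weight_le_maxWeight α)⟩ ∈
          G.dartGraph.between (.col α) (.col β) := by
      rw [between_col_col hαβ]
      exact Finset.mem_image_of_mem _ (Finset.mem_filter.2 ⟨Finset.mem_univ _,
        hk.trans_le (two_le_weight α), hk.trans_le (two_le_weight β)⟩)
    exact ⟨_, mem_between zero_lt_two, _, mem_between one_lt_two, by simp⟩

section FreeRing

variable {R : Type*} [Ring R]

variable (R) in
/-- The edge or ghost edge given by an oriented edge of the dart graph. The value is irrelevant on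
pairs of nodes that are not adjacent. -/
noncomputable def dart : G.Node → G.Node → G.FreeRing R
  | .row _ i, .col α => G.edg R α i
  | .col α, .row _ i => G.gho R α i
  | _, _ => 0

theorem lt_weight_of_edg_ne_zero (h : G.edg R α i ≠ 0) : i < G.weight α := by
  by_contra hi
  exact h (dif_neg hi)

theorem lt_weight_of_gho_ne_zero (h : G.gho R α i ≠ 0) : i < G.weight α := by
  by_contra hi
  exact h (dif_neg hi)

theorem sum_dart_row_mul_dart_row (i j : Fin (G.maxWeight x)) :
    ∑ y ∈ G.dartGraph.between (.row x i) (.row x j), dart R (.row x i) y * dart R y (.row x j) =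
      ∑ α ∈ G.out x, G.edg R α i * G.gho R α j := by
  rw [between_row_row, Finset.sum_image fun _ _ _ _ h => Node.col.inj h]
  exact Finset.sum_filter_of_ne fun α _ h => ⟨lt_weight_of_edg_ne_zero (left_ne_zero_of_mul h),
    lt_weight_of_gho_ne_zero (right_ne_zero_of_mul h)⟩

theorem sum_dart_col_mul_dart_col (h : G.src α = G.src β) :
    ∑ y ∈ G.dartGraph.between (.col α) (.col β), dart R (.col α) y * dart R y (.col β) =
      ∑ i ∈ Finset.range (max (G.weight α) (G.weight β)), G.gho R α i * G.edg R β i := by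
  have bound : max (G.weight α) (G.weight β) ≤ G.maxWeight (G.src α) :=
    max_le (weight_le_maxWeight α) (h ▸ weight_le_maxWeight β)
  rw [between_col_col h, Finset.sum_image fun _ _ _ _ h => eq_of_heq (Node.row.inj h).2,
    Finset.sum_subset (Finset.range_mono bound),
    ← Fin.sum_univ_eq_sum_range fun i => G.gho R α i * G.edg R β i]
  · exact Finset.sum_filter_of_ne fun i _ h => ⟨lt_weight_of_gho_ne_zero (left_ne_zero_of_mul h),
      lt_weight_of_edg_ne_zero (right_ne_zero_of_mul h)⟩
  · intro i _ hi
    by_contra h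
    exact hi (Finset.mem_range.2
      ((lt_weight_of_gho_ne_zero (left_ne_zero_of_mul h)).trans_le (le_max_left _ _)))

theorem row_eq_row_iff {i j : Fin (G.maxWeight x)} : Node.row x i = Node.row x j ↔ i.1 = j.1 := by
  rw [Node.row.injEq, heq_eq_eq, eq_self_iff_true, true_and, Fin.ext_iff]

variable {A : Type*} [NonUnitalRing A]

theorem isDartFamily_of_map_eq (f : G.FreeRing R →ₙ+* A)
    (hf : ∀ a b, G.LeavittRel R a b → f a = f b) :
    G.dartGraph.IsDartFamily (fun v => f (G.vtx R v)) (fun a b => f (dart R a b)) where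
  vertex_mul_vertex v w := by
    rw [← map_mul, hf _ _ (.vertex_mul v w), apply_ite f, map_zero]
  vertex_mul_dart {a b} h := by
    rw [← map_mul]
    obtain ⟨x, i⟩ | α := a <;> obtain ⟨y, j⟩ | β := b
    · exact h.elim
    · obtain ⟨rfl, hi⟩ := h
      exact hf _ _ (.src_edge β i hi)
    · exact hf _ _ (.rng_ghost α j h.2)
    · exact h.elim
  dart_mul_vertex {a b} h := by
    rw [← map_mul]
    obtain ⟨x, i⟩ | α := a <;> obtain ⟨y, j⟩ | β := b
    · exact h.elim
    · exact hf _ _ (.edge_rng β i h.2)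
    · obtain ⟨rfl, hj⟩ := h
      exact hf _ _ (.ghost_src α j hj)
    · exact h.elim
  sum_dart_mul_dart {a c} h := by
    simp only [← map_mul, ← map_sum]
    obtain ⟨x, i⟩ | α := a <;> obtain ⟨y, j⟩ | β := c
    · obtain rfl : x = y := eq_of_topEdge_eq (Node.col.inj h)
      rw [sum_dart_row_mul_dart_row, hf _ _ (.sum_edge_ghost x i j i.2 j.2), apply_ite f, map_zero]
      exact if_congr row_eq_row_iff.symm rfl rfl
    · cases h
    · cases h
    · rw [sum_dart_col_mul_dart_col (Node.row.inj h).1, hf _ _ (.sum_ghost_edge α β), apply_ite f,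
        map_zero]
      exact if_congr ⟨congrArg _, Node.col.inj⟩ rfl rfl

section OfDartFamily

variable {f : G.FreeRing R →ₙ+* A} {e : V → A} {d : G.Node → G.Node → A}
  (h : G.dartGraph.IsDartFamily e d)
  (hd : ∀ {a b}, G.dartGraph.graph.Adj a b → f (dart R a b) = d a b)

include h hd

theorem map_gho_mul_edg_of_ne (hαβ : G.src α ≠ G.src β) :
    f (G.gho R α i * G.edg R β i) = 0 := by
  by_contra hne
  have hα := lt_weight_of_gho_ne_zero (left_ne_zero_of_mul (ne_zero_of_map hne))
  have hβ := lt_weight_of_edg_ne_zero (right_ne_zero_of_mul (ne_zero_of_map hne))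
  rw [map_mul] at hne
  exact hne ((congrArg₂ (· * ·) (hd (adj_col hα)) (hd (adj_row hβ))).trans
    (h.dart_mul_dart_of_ne (adj_col hα) (adj_row hβ) hαβ))

theorem map_sum_dart_mul_dart {a c : G.Node} (hac : G.dartGraph.pivot a = G.dartGraph.pivot c) :
    f (∑ b ∈ G.dartGraph.between a c, dart R a b * dart R b c) =
      if a = c then e (G.dartGraph.vertex a) else 0 := by
  rw [map_sum, ← h.sum_dart_mul_dart hac]
  refine Finset.sum_congr rfl fun b hb => ?_
  obtain ⟨hab, hcb⟩ := PivotedGraph.mem_between.1 hb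
  rw [map_mul, hd hab, hd hcb.symm]

theorem map_eq_of_leavittRel (hv : ∀ v, f (G.vtx R v) = e v) {a b : G.FreeRing R}
    (hab : G.LeavittRel R a b) : f a = f b := by
  have map_edg {α i} (hi : i < G.weight α) : f (G.edg R α i) = d _ _ := hd (adj_row hi)
  have map_gho {α i} (hi : i < G.weight α) : f (G.gho R α i) = d _ _ := hd (adj_col hi)
  cases hab with
  | vertex_mul x y => rw [map_mul, hv, hv, h.vertex_mul_vertex, apply_ite f, map_zero, hv]
  | src_edge α i hi => rw [map_mul, hv, map_edg hi]; exact h.vertex_mul_dart (adj_row hi)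
  | edge_rng α i hi => rw [map_mul, hv, map_edg hi]; exact h.dart_mul_vertex (adj_row hi)
  | rng_ghost α i hi => rw [map_mul, hv, map_gho hi]; exact h.vertex_mul_dart (adj_col hi)
  | ghost_src α i hi => rw [map_mul, hv, map_gho hi]; exact h.dart_mul_vertex (adj_col hi)
  | sum_edge_ghost x i j hi hj =>
    rw [← sum_dart_row_mul_dart_row ⟨i, hi⟩ ⟨j, hj⟩,
      map_sum_dart_mul_dart h hd (pivot_row_eq_pivot_row _ _), apply_ite f, map_zero, hv]
    exact if_congr row_eq_row_iff rfl rfl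
  | sum_ghost_edge α β =>
    rw [apply_ite f, map_zero, hv]
    by_cases hαβ : G.src α = G.src β
    · rw [← sum_dart_col_mul_dart_col hαβ, map_sum_dart_mul_dart h hd (pivot_col_eq_pivot_col hαβ)]
      exact if_congr ⟨Node.col.inj, congrArg _⟩ rfl rfl
    · rw [map_sum, Finset.sum_eq_zero fun i _ => map_gho_mul_edg_of_ne h hd hαβ,
        if_neg fun hne => hαβ (congrArg _ hne)]

end OfDartFamily

end FreeRing

section LeavittPathAlgebra

variable (G) (R : Type*) [Ring R]

/-- The quotient map onto the weighted Leavitt path algebra. -/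
noncomputable def toLeavitt : G.FreeRing R →ₙ+* G.LeavittPathAlgebra R where
  toFun a := (a : (G.leavittIdeal R).ringCon.Quotient)
  map_mul' _ _ := rfl
  map_zero' := rfl
  map_add' _ _ := rfl

theorem toLeavitt_surjective : Function.Surjective (G.toLeavitt R) := fun a =>
  Quotient.inductionOn' a fun a => ⟨a, rfl⟩

variable {R}

theorem rel_iff_sub_mem (a b : G.FreeRing R) :
    (G.leavittIdeal R).ringCon a b ↔ a - b ∈ G.leavittIdeal R := TwoSidedIdeal.rel_iff _ _ _

theorem toLeavitt_eq_of_rel (a b : G.FreeRing R) (h : G.LeavittRel R a b) :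
    G.toLeavitt R a = G.toLeavitt R b := by
  refine (RingCon.eq _).2 ((G.rel_iff_sub_mem a b).2 ?_)
  rw [leavittIdeal, TwoSidedIdeal.mem_sInf]
  exact fun J hJ => hJ.2.2 a b h

theorem smul_mem_leavittIdeal (r : R) {a : G.FreeRing R} (ha : a ∈ G.leavittIdeal R) :
    r • a ∈ G.leavittIdeal R := by
  rw [leavittIdeal, TwoSidedIdeal.mem_sInf] at ha ⊢
  exact fun J hJ => hJ.1 r a (ha J hJ)

noncomputable instance : SMul R (G.LeavittPathAlgebra R) where
  smul r := Quotient.map' (r • ·) fun a b h => by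
    refine (G.rel_iff_sub_mem _ _).2 ?_
    rw [← smul_sub]
    exact G.smul_mem_leavittIdeal r ((G.rel_iff_sub_mem a b).1 h)

variable {G} in
theorem toLeavitt_smul (r : R) (a : G.FreeRing R) :
    G.toLeavitt R (r • a) = r • G.toLeavitt R a := rfl

noncomputable instance : Module R (G.LeavittPathAlgebra R) :=
  (G.toLeavitt_surjective R).module R (G.toLeavitt R : G.FreeRing R →+ _) toLeavitt_smul

instance : IsScalarTower R (G.LeavittPathAlgebra R) (G.LeavittPathAlgebra R) where
  smul_assoc r a b := by
    obtain ⟨a, rfl⟩ := G.toLeavitt_surjective R a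
    obtain ⟨b, rfl⟩ := G.toLeavitt_surjective R b
    simp only [smul_eq_mul, ← toLeavitt_smul, ← map_mul, smul_mul_assoc]

variable (R)

/-- The vertex `v` in the weighted Leavitt path algebra. -/
noncomputable def vertexElt (v : V) : G.LeavittPathAlgebra R := G.toLeavitt R (G.vtx R v)

/-- The edges and ghost edges in the weighted Leavitt path algebra. -/
noncomputable def dartElt (a b : G.Node) : G.LeavittPathAlgebra R := G.toLeavitt R (dart R a b)

theorem isDartFamily_dartElt : G.dartGraph.IsDartFamily (G.vertexElt R) (G.dartElt R) :=
  isDartFamily_of_map_eq (G.toLeavitt R) G.toLeavitt_eq_of_rel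

variable {G R}

theorem edg_fin (α : E) (i : Fin (G.weight α)) : G.edg R α i = G.gen R (.edge α i) :=
  dif_pos i.2

theorem gho_fin (α : E) (i : Fin (G.weight α)) : G.gho R α i = G.gen R (.ghost α i) :=
  dif_pos i.2

theorem gen_mul_smul (l : G.Letter) (r : R) (a : G.FreeRing R) :
    G.gen R l * (r • a) = r • (G.gen R l * a) := by
  induction a using MonoidAlgebra.induction_linear with
  | zero => simp
  | add a b ha hb => rw [smul_add, mul_add, mul_add, smul_add, ha, hb]
  | single w s => simp [gen, MonoidAlgebra.single_mul_single]

@[elab_as_elim]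
theorem leavitt_induction {p : G.LeavittPathAlgebra R → Prop} (zero : p 0)
    (add : ∀ a b, p a → p b → p (a + b)) (smul : ∀ (r : R) a, p a → p (r • a))
    (mul : ∀ a b, p a → p b → p (a * b)) (vertex : ∀ v, p (G.vertexElt R v))
    (dart : ∀ {x y}, G.dartGraph.graph.Adj x y → p (G.dartElt R x y))
    (a : G.LeavittPathAlgebra R) : p a := by
  have letter (l : G.Letter) : p (G.toLeavitt R (G.gen R l)) := by
    obtain v | ⟨α, i⟩ | ⟨α, i⟩ := l
    · exact vertex v
    · rw [← edg_fin]
      exact dart (adj_row i.2)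
    · rw [← gho_fin]
      exact dart (adj_col i.2)
  have word (w : FreeSemigroup G.Letter) : p (G.toLeavitt R (.single w 1)) := by
    induction w using FreeSemigroup.recOnMul with
    | ih1 l => exact letter l
    | ih2 l w _ hw =>
      rw [← one_mul (1 : R), ← MonoidAlgebra.single_mul_single, map_mul]
      exact mul _ _ (letter l) hw
  obtain ⟨a, rfl⟩ := G.toLeavitt_surjective R a
  induction a using MonoidAlgebra.induction_linear with
  | zero => exact zero
  | add a b ha hb => exact add _ _ ha hb
  | single w r =>
    rw [← mul_one r, ← smul_eq_mul, ← MonoidAlgebra.smul_single, toLeavitt_smul]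
    exact smul r _ (word w)

end LeavittPathAlgebra

section Representation

variable {R : Type*} [Ring R] {M : Type*} [AddCommGroup M] [Module R M]

/-- The values on letters of a family of operators for the vertices and the oriented edges. -/
noncomputable def letterOp (e : V → Module.End R M) (d : G.Node → G.Node → Module.End R M) :
    G.Letter → Module.End R M
  | .vertex v => e v
  | .edge α i => d (.row (G.src α) (i.castLE (weight_le_maxWeight α))) (.col α)
  | .ghost α i => d (.col α) (.row (G.src α) (i.castLE (weight_le_maxWeight α)))

/-- The action of the free `R`-ring given by a family of operators for the vertices and the
oriented edges. -/
noncomputable def freeRep (e : V → Module.End R M) (d : G.Node → G.Node → Module.End R M) :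
    G.FreeRing R →ₙ+* AddMonoid.End M :=
  addEndOfMulHom (FreeSemigroup.lift (letterOp e d))

variable {e : V → Module.End R M} {d : G.Node → G.Node → Module.End R M}

theorem freeRep_gen (l : G.Letter) (m : M) :
    freeRep e d (G.gen R l) m = letterOp e d l m := by
  rw [freeRep, gen, addEndOfMulHom_single, one_smul, FreeSemigroup.lift_of]

theorem freeRep_dart {a b : G.Node} (hab : G.dartGraph.graph.Adj a b) (m : M) :
    freeRep e d (dart R a b) m = d a b m := by
  obtain ⟨x, i⟩ | α := a <;> obtain ⟨y, j⟩ | β := b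
  · exact hab.elim
  · obtain ⟨rfl, hi⟩ := hab
    exact (congrArg (freeRep e d · m) (edg_fin β ⟨i, hi⟩)).trans (freeRep_gen _ m)
  · obtain ⟨rfl, hj⟩ := hab
    exact (congrArg (freeRep e d · m) (gho_fin α ⟨j, hj⟩)).trans (freeRep_gen _ m)
  · exact hab.elim

variable (h : G.dartGraph.IsDartFamily e d)

include h

theorem freeRep_eq_of_leavittRel {a b : G.FreeRing R} (hab : G.LeavittRel R a b) :
    freeRep e d a = freeRep e d b :=
  map_eq_of_leavittRel (h.map (Module.toAddMonoidEnd (Module.End R M) M).toNonUnitalRingHom)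
    (fun hxy => AddMonoidHom.ext (freeRep_dart hxy)) (fun _ => AddMonoidHom.ext (freeRep_gen _)) hab

theorem freeRep_eq_zero_of_mem {a : G.FreeRing R} (ha : a ∈ G.leavittIdeal R) :
    freeRep e d a = 0 := by
  suffices G.leavittIdeal R ≤ TwoSidedIdeal.ker (freeRep e d) from
    (TwoSidedIdeal.mem_ker _).1 (this ha)
  refine sInf_le ⟨fun r a ha => ?_, fun r a ha => ?_, fun a b hab => ?_⟩ <;>
    rw [TwoSidedIdeal.mem_ker] at *
  · exact AddMonoidHom.ext fun m => (addEndOfMulHom_smul _ r a m).trans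
      ((congrArg (r • · m) ha).trans (smul_zero r))
  · exact AddMonoidHom.ext fun m => (addEndOfMulHom_op_smul _ r a m).trans
      (DFunLike.congr_fun ha (r • m))
  · rw [map_sub, sub_eq_zero, freeRep_eq_of_leavittRel h hab]

/-- The action of the weighted Leavitt path algebra given by operators which satisfy the relations
of the dart graph. -/
noncomputable def leavittRep : G.LeavittPathAlgebra R →ₙ+* AddMonoid.End M where
  toFun a := Quotient.liftOn' a (freeRep e d) fun a b hab => by
    rw [← sub_eq_zero, ← map_sub]
    exact freeRep_eq_zero_of_mem h ((G.rel_iff_sub_mem a b).1 hab)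
  map_mul' a b := Quotient.inductionOn₂' a b (map_mul (freeRep e d))
  map_zero' := map_zero (freeRep e d)
  map_add' a b := Quotient.inductionOn₂' a b (map_add (freeRep e d))

theorem leavittRep_smul (r : R) (a : G.LeavittPathAlgebra R) (m : M) :
    leavittRep h (r • a) m = r • leavittRep h a m :=
  Quotient.inductionOn' a fun a => addEndOfMulHom_smul _ r a m

theorem leavittRep_vertexElt (v : V) (m : M) : leavittRep h (G.vertexElt R v) m = e v m :=
  freeRep_gen _ m

theorem leavittRep_dartElt {a b : G.Node} (hab : G.dartGraph.graph.Adj a b) (m : M) :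
    leavittRep h (G.dartElt R a b) m = d a b m :=
  freeRep_dart hab m

end Representation

section NormalForm

variable {R : Type*} [Ring R]

theorem vertexElt_mul_smul (v : V) (r : R) (a : G.LeavittPathAlgebra R) :
    G.vertexElt R v * r • a = r • (G.vertexElt R v * a) := by
  obtain ⟨a, rfl⟩ := G.toLeavitt_surjective R a
  exact congrArg (G.toLeavitt R) (gen_mul_smul _ r a)

theorem dartElt_mul_smul (a b : G.Node) (r : R) (c : G.LeavittPathAlgebra R) :
    G.dartElt R a b * r • c = r • (G.dartElt R a b * c) := by
  obtain ⟨c, rfl⟩ := G.toLeavitt_surjective R c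
  refine congrArg (G.toLeavitt R) (?_ : dart R a b * r • c = r • (dart R a b * c))
  obtain ⟨x, i⟩ | α := a <;> obtain ⟨y, j⟩ | β := b <;> simp only [dart, edg, gho] <;>
    (try split_ifs) <;> simp only [gen_mul_smul, zero_mul, smul_zero]

open Filter in
theorem eventually_mul_sum_vertexElt (a : G.LeavittPathAlgebra R) :
    ∀ᶠ F : Finset V in atTop, a * ∑ v ∈ F, G.vertexElt R v = a := by
  have h := G.isDartFamily_dartElt R
  induction a using leavitt_induction with
  | zero => exact .of_forall fun F => zero_mul _
  | add a b ha hb => filter_upwards [ha, hb] with F ha hb; rw [add_mul, ha, hb]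
  | smul r a ha => filter_upwards [ha] with F ha; rw [smul_mul_assoc, ha]
  | mul a b _ hb => filter_upwards [hb] with F hb; rw [mul_assoc, hb]
  | vertex v =>
    filter_upwards [eventually_ge_atTop {v}] with F hF
    exact h.vertex_mul_sum (Finset.singleton_subset_iff.1 hF)
  | @dart x y hxy =>
    filter_upwards [eventually_ge_atTop {G.dartGraph.vertex y}] with F hF
    rw [← h.dart_mul_vertex hxy, mul_assoc, h.vertex_mul_sum (Finset.singleton_subset_iff.1 hF)]

open Filter in
theorem eventually_sum_vertexElt_mul (a : G.LeavittPathAlgebra R) :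
    ∀ᶠ F : Finset V in atTop, (∑ v ∈ F, G.vertexElt R v) * a = a := by
  have h := G.isDartFamily_dartElt R
  induction a using leavitt_induction with
  | zero => exact .of_forall fun F => mul_zero _
  | add a b ha hb => filter_upwards [ha, hb] with F ha hb; rw [mul_add, ha, hb]
  | smul r a ha =>
    filter_upwards [ha] with F ha
    simp only [Finset.sum_mul, vertexElt_mul_smul, ← Finset.smul_sum] at ha ⊢
    rw [ha]
  | mul a b ha _ => filter_upwards [ha] with F ha; rw [← mul_assoc, ha]
  | vertex v =>
    filter_upwards [eventually_ge_atTop {v}] with F hF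
    exact h.sum_mul_vertex (Finset.singleton_subset_iff.1 hF)
  | @dart x y hxy =>
    filter_upwards [eventually_ge_atTop {G.dartGraph.vertex x}] with F hF
    rw [← h.vertex_mul_dart hxy, ← mul_assoc, h.sum_mul_vertex (Finset.singleton_subset_iff.1 hF)]

theorem exists_mul_vertexElt_ne_zero {a : G.LeavittPathAlgebra R} (ha : a ≠ 0) :
    ∃ v, a * G.vertexElt R v ≠ 0 := by
  obtain ⟨F, hF⟩ := (eventually_mul_sum_vertexElt a).exists
  rw [← hF, Finset.mul_sum] at ha
  obtain ⟨v, -, hv⟩ := Finset.exists_ne_zero_of_sum_ne_zero ha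
  exact ⟨v, hv⟩

theorem exists_vertexElt_mul_ne_zero {a : G.LeavittPathAlgebra R} (ha : a ≠ 0) :
    ∃ v, G.vertexElt R v * a ≠ 0 := by
  obtain ⟨F, hF⟩ := (eventually_sum_vertexElt_mul a).exists
  rw [← hF, Finset.sum_mul] at ha
  obtain ⟨v, -, hv⟩ := Finset.exists_ne_zero_of_sum_ne_zero ha
  exact ⟨v, hv⟩

variable (G R) in
/-- The element of the weighted Leavitt path algebra given by a combination of normal words. -/
noncomputable abbrev ofNormal (u : V) :
    (G.dartGraph.NormalWord u →₀ R) →ₗ[R] G.LeavittPathAlgebra R :=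
  PivotedGraph.eval (G.vertexElt R) (G.dartElt R) u

theorem ofNormal_injective (u : V) : Function.Injective (G.ofNormal R u) :=
  have h := G.dartGraph.isDartFamily_op u R
  PivotedGraph.eval_injective (f := leavittRep h) (leavittRep_smul h) (leavittRep_vertexElt h u)
    (leavittRep_dartElt h)

theorem exists_ofNormal_eq_mul {u : V} (a : G.LeavittPathAlgebra R)
    (m : G.dartGraph.NormalWord u →₀ R) : ∃ l, G.ofNormal R u l = a * G.ofNormal R u m := by
  have h := G.isDartFamily_dartElt R
  induction a using leavitt_induction generalizing m with
  | zero => exact ⟨0, (map_zero _).trans (zero_mul _).symm⟩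
  | add a b ha hb =>
    obtain ⟨⟨l, hl⟩, l', hl'⟩ := And.intro (ha m) (hb m)
    exact ⟨l + l', by rw [map_add, hl, hl', add_mul]⟩
  | smul r a ha =>
    obtain ⟨l, hl⟩ := ha m
    exact ⟨r • l, by rw [map_smul, hl, smul_mul_assoc]⟩
  | mul a b ha hb =>
    obtain ⟨l, hl⟩ := hb m
    obtain ⟨l', hl'⟩ := ha l
    exact ⟨l', by rw [hl', hl, mul_assoc]⟩
  | vertex v => exact ⟨_, h.eval_vertexOp (vertexElt_mul_smul v) m⟩
  | dart hxy => exact ⟨_, h.eval_dartOp hxy (dartElt_mul_smul _ _) m⟩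

theorem exists_ofNormal_eq_mul_vertexElt (a : G.LeavittPathAlgebra R) (u : V) :
    ∃ l, G.ofNormal R u l = a * G.vertexElt R u := by
  obtain ⟨l, hl⟩ := exists_ofNormal_eq_mul a (PivotedGraph.mono [])
  exact ⟨l, by rw [hl, PivotedGraph.eval_mono PivotedGraph.isNormal_nil, PivotedGraph.wordElt]⟩

theorem mul_vertexElt_mul_ne_zero [NoZeroDivisors R] (hG : G.dartGraph.IsBranching)
    {a b : G.LeavittPathAlgebra R} {v : V} (ha : a * G.vertexElt R v ≠ 0)
    (hb : G.vertexElt R v * b ≠ 0) : a * G.vertexElt R v * b ≠ 0 := by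
  have h := G.isDartFamily_dartElt R
  obtain ⟨u, hu⟩ := exists_mul_vertexElt_ne_zero hb
  obtain ⟨l, hl⟩ := exists_ofNormal_eq_mul_vertexElt a v
  obtain ⟨k, hk⟩ := exists_ofNormal_eq_mul_vertexElt b u
  set m := G.dartGraph.vertexOp u R v k
  have hm : G.ofNormal R u m = G.vertexElt R v * b * G.vertexElt R u := by
    rw [h.eval_vertexOp (vertexElt_mul_smul v), hk, mul_assoc]
  have act_ne_zero : PivotedGraph.act m l ≠ 0 :=
    PivotedGraph.act_ne_zero hG (PivotedGraph.vertexOp_mem_startingAt k)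
      (ne_zero_of_map (hl.trans_ne ha)) (ne_zero_of_map (hm.trans_ne hu))
  have product : a * G.vertexElt R v * b * G.vertexElt R u =
      G.ofNormal R u (PivotedGraph.act m l) := by
    rw [← h.eval_mul_eval vertexElt_mul_smul dartElt_mul_smul
      (PivotedGraph.vertexOp_mem_startingAt k), hl, hm, ← mul_assoc, ← mul_assoc,
      mul_assoc a (G.vertexElt R v) (G.vertexElt R v), h.vertex_mul_vertex, if_pos rfl]
  refine left_ne_zero_of_mul (product.trans_ne ?_)
  exact (map_ne_zero_iff _ (ofNormal_injective u)).2 act_ne_zero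

end NormalForm

end WeightedGraph

section Nonsingular

variable {A : Type*} [NonUnitalRing A] {ι : Type*} {e : ι → A}

theorem isRightNonsingular_of_mul_mul_ne_zero (hidem : ∀ i, e i * e i = e i)
    (exists_ne : ∀ a ≠ 0, ∃ i, a * e i ≠ 0)
    (mul_ne : ∀ i a b, a * e i ≠ 0 → e i * b ≠ 0 → a * e i * b ≠ 0) : IsRightNonsingular A := by
  intro a hess
  by_contra ha
  obtain ⟨i, hi⟩ := exists_ne a ha
  let J : AddSubgroup A := (AddMonoidHom.mulLeft (e i)).range
  have hJ : IsRightIdeal J := by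
    rintro _ ⟨b, rfl⟩ c
    exact ⟨b * c, (mul_assoc _ _ _).symm⟩
  have hJ₀ : J ≠ ⊥ := fun h =>
    right_ne_zero_of_mul hi ((AddSubgroup.eq_bot_iff_forall J).1 h _ ⟨e i, hidem i⟩)
  refine hess.2 J hJ hJ₀ ((AddSubgroup.eq_bot_iff_forall _).2 ?_)
  rintro _ ⟨hab, b, rfl⟩
  by_contra hb
  exact mul_ne i a b hi hb ((mul_assoc _ _ _).trans hab)

theorem isLeftNonsingular_of_mul_mul_ne_zero (hidem : ∀ i, e i * e i = e i)
    (exists_ne : ∀ a ≠ 0, ∃ i, e i * a ≠ 0)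
    (mul_ne : ∀ i a b, a * e i ≠ 0 → e i * b ≠ 0 → a * e i * b ≠ 0) : IsLeftNonsingular A := by
  intro a hess
  by_contra ha
  obtain ⟨i, hi⟩ := exists_ne a ha
  let J : AddSubgroup A := (AddMonoidHom.mulRight (e i)).range
  have hJ : IsLeftIdeal J := by
    rintro _ ⟨b, rfl⟩ c
    exact ⟨c * b, mul_assoc _ _ _⟩
  have hJ₀ : J ≠ ⊥ := fun h =>
    left_ne_zero_of_mul hi ((AddSubgroup.eq_bot_iff_forall J).1 h _ ⟨e i, hidem i⟩)
  refine hess.2 J hJ hJ₀ ((AddSubgroup.eq_bot_iff_forall _).2 ?_)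
  rintro _ ⟨hba, b, rfl⟩
  by_contra hb
  exact mul_ne i b a hb hi hba

end Nonsingular

theorem mainTheorem11_general {V E R : Type*} [Ring R] [NoZeroDivisors R] (G : WeightedGraph V E)
    (two_le_weight : ∀ α, 2 ≤ G.weight α)
    (two_le_card : ∀ x, (G.out x).Nonempty →
      2 ≤ ((G.out x).filter fun α => G.weight α = G.maxWeight x).card) :
    IsLeftNonsingular (G.LeavittPathAlgebra R) ∧ IsRightNonsingular (G.LeavittPathAlgebra R) := by
  have idempotent (v : V) : G.vertexElt R v * G.vertexElt R v = G.vertexElt R v :=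
    ((G.isDartFamily_dartElt R).vertex_mul_vertex v v).trans (if_pos rfl)
  have mul_ne_zero (v : V) (a b : G.LeavittPathAlgebra R) :
      a * G.vertexElt R v ≠ 0 → G.vertexElt R v * b ≠ 0 → a * G.vertexElt R v * b ≠ 0 :=
    WeightedGraph.mul_vertexElt_mul_ne_zero
      (WeightedGraph.isBranching_dartGraph two_le_weight two_le_card)
  exact ⟨isLeftNonsingular_of_mul_mul_ne_zero idempotent
      (fun _ => WeightedGraph.exists_vertexElt_mul_ne_zero) mul_ne_zero,
    isRightNonsingular_of_mul_mul_ne_zero idempotent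
      (fun _ => WeightedGraph.exists_mul_vertexElt_ne_zero) mul_ne_zero⟩

theorem mainTheorem11 {V E R : Type*} [Countable V] [Countable E] [Ring R] [IsDomain R]
    (G : WeightedGraph V E) (hG : G.IsLV) :
    IsLeftNonsingular (G.LeavittPathAlgebra R) ∧ IsRightNonsingular (G.LeavittPathAlgebra R) :=
  mainTheorem11_general G hG.two_le_weight hG.two_le_card
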